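/- **Notation.** Let $\mathbb S=\{z\in\mathbb C:0<\operatorname{Re}z<1\}$, and let $\ell_\infty$, $\ell_1$ be the complex sequence spaces over $\mathbb N$. Let $\mathscr Z=\mathscr C(\ell_\infty,\ell_1)$ be the Calderón space of the couple $(\ell_\infty,\ell_1)$: the space of all bounded functions $f:\overline{\mathbb S}\to\ell_\infty$ that are continuous on $\overline{\mathbb S}$ and analytic on $\mathbb S$ (with respect to the norm of $\ell_\infty$) and such that $t\mapsto f(1+it)$ is a bounded continuous function from $\mathbb R$ to $\ell_1$, with the norm $$\|f\|_{\mathscr Z}=\sup\{\|f(it)\|_\infty,\ \|f(1+it)\|_1:\ t\in\mathbb R\}.$$ For $n\ge1$ let $\mathscr Z_n$ be the $n$-th Rochberg space of $\mathscr Z$ at the point $1/2$, $$\mathscr Z_n=\Big\{(w_{n-1},\dots,w_0)\in(\ell_\infty)^n:\ \text{there is } f\in\mathscr Z \text{ with } w_i=\tfrac{f^{(i)}(1/2)}{i!}\text{ for all }0\le i<n\Big\},$$ with the quotient norm: $\|w\|_{\mathscr Z_n}$ is the infimum of $\|f\|_{\mathscr Z}$ over all such $f$. **Corollary.** For all integers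 $n,k\ge1$, the space $\mathscr Z_{n+k}$ is not isomorphic to $\mathscr Z_n\oplus\mathscr Z_k$; that is, there is no $\mathbb C$-linear homeomorphism from $\mathscr Z_{n+k}$ onto $\mathscr Z_n\oplus\mathscr Z_k$. -/

import Mathlib

open scoped ENNReal BoundedContinuousFunction

noncomputable section

namespace Rochberg

/-- The complex Banach space `ℓ_∞`. -/
abbrev LInf : Type := lp (fun _ : ℕ => ℂ) ∞

/-- The complex Banach space `ℓ_1`. -/
abbrev LOne : Type := lp (fun _ : ℕ => ℂ) 1

/-- The open unit strip `{z : 0 < Re z < 1}`. -/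
def strip : Set ℂ := Complex.re ⁻¹' Set.Ioo 0 1

/-- The closed unit strip `{z : 0 ≤ Re z ≤ 1}`. -/
def closedStrip : Set ℂ := Complex.re ⁻¹' Set.Icc 0 1

/-- The functions in the Calderón space of the couple `(ℓ_∞, ℓ_1)` on the unit strip: analytic on
the open strip, continuous and bounded on the closed one, all with respect to the norm of `ℓ_∞`, and
such that `t ↦ f (1 + it)` is a bounded continuous function with values in `ℓ_1`.
(That `t ↦ f (it)` is a bounded continuous function with values in `ℓ_∞` is then clear.)
Since functions are total, a function on the closed strip is represented by its extension by zero. -/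
structure IsCalderon (f : ℂ → LInf) : Prop where
  diffContOnCl : DiffContOnCl ℂ f strip
  bounded : ∃ C : ℝ, ∀ z ∈ closedStrip, ‖f z‖ ≤ C
  right : ∃ g : ℝ →ᵇ LOne, ∀ (t : ℝ) (k : ℕ), g t k = f (1 + Complex.I * t) k
  eq_zero : ∀ z, z ∉ closedStrip → f z = 0

/-- The Calderón space of `(ℓ_∞, ℓ_1)` as a linear space of functions. -/
def calderonSubmodule : Submodule ℂ (ℂ → LInf) where
  carrier := {f | IsCalderon f}
  zero_mem' := by
    refine ⟨diffContOnCl_const, ⟨0, by simp⟩, ⟨0, fun _ _ => rfl⟩, by simp⟩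
  add_mem' := by
    rintro f g ⟨hf, ⟨C, hC⟩, ⟨u, hu⟩, hf0⟩ ⟨hg, ⟨D, hD⟩, ⟨v, hv⟩, hg0⟩
    refine ⟨hf.add hg, ⟨C + D, fun z hz => (norm_add_le _ _).trans
      (add_le_add (hC z hz) (hD z hz))⟩, ⟨u + v, fun t k => ?_⟩, fun z hz => ?_⟩
    · exact congrArg₂ (· + ·) (hu t k) (hv t k)
    · simp [hf0 z hz, hg0 z hz]
  smul_mem' := by
    rintro c f ⟨hf, ⟨C, hC⟩, ⟨u, hu⟩, hf0⟩
    refine ⟨hf.const_smul c, ⟨‖c‖ * C, fun z hz => ?_⟩, ⟨c • u, fun t k => ?_⟩, fun z hz => ?_⟩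
    · rw [Pi.smul_apply, norm_smul]
      exact mul_le_mul_of_nonneg_left (hC z hz) (norm_nonneg _)
    · exact congrArg (c * ·) (hu t k)
    · simp [hf0 z hz]

/-- The Calderón space `𝒵 = 𝒞(ℓ_∞, ℓ_1)` on the unit strip. -/
def Calderon : Type := ↥calderonSubmodule

namespace Calderon

instance : AddCommGroup Calderon := inferInstanceAs (AddCommGroup ↥calderonSubmodule)
instance : Module ℂ Calderon := inferInstanceAs (Module ℂ ↥calderonSubmodule)
instance : CoeFun Calderon (fun _ => ℂ → LInf) := ⟨fun f => f.1⟩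

theorem isCalderon (f : Calderon) : IsCalderon f := f.2

@[ext] theorem ext {f g : Calderon} (h : ∀ z, f z = g z) : f = g := Subtype.ext (funext h)

@[simp] theorem coe_add (f g : Calderon) : ((f + g : Calderon) : ℂ → LInf) = f + g := rfl
@[simp] theorem coe_smul (c : ℂ) (f : Calderon) : ((c • f : Calderon) : ℂ → LInf) = c • f := rfl

theorem continuousOn (f : Calderon) : ContinuousOn f closedStrip := by
  have h := f.isCalderon.diffContOnCl.continuousOn
  rwa [strip, Complex.closure_preimage_re, closure_Ioo (by norm_num)] at h

/-- The boundary function `t ↦ f (it)`, with values in `ℓ_∞`. -/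
def left (f : Calderon) : ℝ →ᵇ LInf :=
  BoundedContinuousFunction.ofNormedAddCommGroup (fun t : ℝ => f (Complex.I * t))
    (f.continuousOn.comp_continuous (by fun_prop) (fun t => by simp [closedStrip]))
    f.isCalderon.bounded.choose
    (fun t => f.isCalderon.bounded.choose_spec _ (by simp [closedStrip]))

/-- The boundary function `t ↦ f (1 + it)`, with values in `ℓ_1`. -/
def right (f : Calderon) : ℝ →ᵇ LOne := f.isCalderon.right.choose

theorem left_apply (f : Calderon) (t : ℝ) : f.left t = f (Complex.I * t) := rfl

theorem right_apply (f : Calderon) (t : ℝ) (k : ℕ) :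
    f.right t k = f (1 + Complex.I * t) k := f.isCalderon.right.choose_spec t k

/-- The pair of boundary functions of `f`. -/
def boundary : Calderon →ₗ[ℂ] (ℝ →ᵇ LInf) × (ℝ →ᵇ LOne) where
  toFun f := (f.left, f.right)
  map_add' f g := by
    refine Prod.ext (by ext; rfl) ?_
    ext t k
    simp [right_apply]
  map_smul' c f := by
    refine Prod.ext (by ext; rfl) ?_
    ext t k
    simp [right_apply]

theorem norm_apply_le (f : Calderon) (z : ℂ) : ‖f z‖ ≤ ‖boundary f‖ := by
  by_cases hz : z ∈ closedStrip
  · obtain ⟨C, hC⟩ := f.isCalderon.bounded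
    refine PhragmenLindelof.vertical_strip (a := 0) (b := 1) f.isCalderon.diffContOnCl
      ⟨0, by positivity, 0, ?_⟩ (fun w hw => ?_) (fun w hw => ?_) hz.1 hz.2
    · refine Asymptotics.IsBigO.of_bound C ?_
      refine Filter.mem_inf_of_right ?_
      intro w hw
      simpa using hC w ⟨hw.1.le, hw.2.le⟩
    · have h := (f.left.norm_coe_le_norm w.im).trans (norm_fst_le (boundary f))
      have hw' : w = Complex.I * w.im := by apply Complex.ext <;> simp [hw]
      rwa [left_apply, ← hw'] at h
    · refine le_trans ?_ ((f.right.norm_coe_le_norm w.im).trans (norm_snd_le (boundary f)))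
      have hw' : w = 1 + Complex.I * w.im := by apply Complex.ext <;> simp [hw]
      refine lp.norm_le_of_forall_le (norm_nonneg _) (fun k => ?_)
      have h := lp.norm_apply_le_norm one_ne_zero (f.right w.im) k
      rw [right_apply, ← hw'] at h
      exact h
  · rw [f.isCalderon.eq_zero z hz, norm_zero]
    exact norm_nonneg _

theorem boundary_injective : Function.Injective boundary := by
  rw [injective_iff_map_eq_zero]
  intro f hf
  ext1 z
  have h := f.norm_apply_le z
  rw [hf, norm_zero] at h
  exact norm_le_zero_iff.1 h

/-- The norm `‖f‖ = max (sup_t ‖f (it)‖_∞) (sup_t ‖f (1 + it)‖_1)`. -/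
instance : NormedAddCommGroup Calderon :=
  NormedAddCommGroup.induced Calderon _ boundary boundary_injective

instance : NormedSpace ℂ Calderon := NormedSpace.induced ℂ Calderon _ boundary

theorem norm_def (f : Calderon) : ‖f‖ = max ‖f.left‖ ‖f.right‖ := rfl

theorem norm_eq_iSup (f : Calderon) : ‖f‖ =
    max (⨆ t : ℝ, ‖f (Complex.I * t)‖) (⨆ t : ℝ, ∑' k : ℕ, ‖f (1 + Complex.I * t) k‖) := by
  rw [norm_def, BoundedContinuousFunction.norm_eq_iSup_norm,
    BoundedContinuousFunction.norm_eq_iSup_norm]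
  congr 2
  funext t
  rw [lp.norm_eq_tsum_rpow (by simp)]
  simp [right_apply]

theorem half_mem : (1 / 2 : ℂ) ∈ strip := by
  simp only [strip, Set.mem_preimage, Set.mem_Ioo]
  norm_num

theorem isOpen_strip : IsOpen strip := isOpen_Ioo.preimage Complex.continuous_re

theorem contDiffAt (f : Calderon) (i : ℕ) : ContDiffAt ℂ i f (1 / 2) :=
  (f.isCalderon.diffContOnCl.differentiableOn.analyticAt
    (isOpen_strip.mem_nhds half_mem)).contDiffAt

theorem norm_iteratedDeriv_le (f : Calderon) (i : ℕ) :
    ‖iteratedDeriv i f (1 / 2)‖ ≤ i.factorial * ‖f‖ / (1 / 4 : ℝ) ^ i := by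
  refine Complex.norm_iteratedDeriv_le_of_forall_mem_sphere_norm_le i (by norm_num)
    (f.isCalderon.diffContOnCl.mono fun z hz => ?_) (fun z _ => f.norm_apply_le z)
  have h1 : |(z - 1 / 2).re| < 1 / 4 :=
    (Complex.abs_re_le_norm _).trans_lt (by simpa [dist_eq_norm] using hz)
  have h2 : (z - 1 / 2).re = z.re - 1 / 2 := by simp
  rw [h2, abs_lt] at h1
  exact ⟨by linarith, by linarith⟩

/-- The list of the first `n` Taylor coefficients `f⁽ⁱ⁾(1/2) / i!`, `i < n`, of `f` at `1/2`. -/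
def jet (n : ℕ) : Calderon →L[ℂ] (Fin n → LInf) :=
  ContinuousLinearMap.pi fun i => LinearMap.mkContinuous
    { toFun := fun f => ((i : ℕ).factorial : ℂ)⁻¹ • iteratedDeriv i f (1 / 2)
      map_add' := fun f g => by
        rw [coe_add, iteratedDeriv_add (f.contDiffAt i) (g.contDiffAt i), smul_add]
      map_smul' := fun c f => by
        rw [coe_smul, iteratedDeriv_const_smul (f.contDiffAt i) c, RingHom.id_apply,
          smul_comm] }
    (((1 / 4 : ℝ) ^ (i : ℕ))⁻¹) (fun f => by
      have h := f.norm_iteratedDeriv_le i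
      have hpos : (0 : ℝ) < (i : ℕ).factorial := by positivity
      simp only [LinearMap.coe_mk, AddHom.coe_mk, norm_smul, norm_inv, Complex.norm_natCast]
      rw [inv_mul_le_iff₀ hpos]
      refine h.trans (le_of_eq ?_)
      rw [div_eq_mul_inv]; ring)

theorem jet_apply (n : ℕ) (f : Calderon) (i : Fin n) :
    jet n f i = ((i : ℕ).factorial : ℂ)⁻¹ • iteratedDeriv i f (1 / 2) := rfl

instance isClosed_ker_jet (n : ℕ) : IsClosed ((jet n).toLinearMap.ker : Set Calderon) :=
  (jet n).isClosed_ker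

end Calderon

/-- The Rochberg space `𝒵_n = 𝒵⁽ⁿ⁾_{1/2}`: the tuples `w` in `(ℓ_∞)ⁿ` whose entries are the first
`n` Taylor coefficients at `1/2` of some `f` in the Calderón space `𝒵`. The entry `w i` is the `i`-th
coefficient. The norm is given below. -/
def Z (n : ℕ) : Type := ↥((Calderon.jet n).toLinearMap.range)

namespace Z

instance (n : ℕ) : AddCommGroup (Z n) :=
  inferInstanceAs (AddCommGroup ↥((Calderon.jet n).toLinearMap.range))
instance (n : ℕ) : Module ℂ (Z n) :=
  inferInstanceAs (Module ℂ ↥((Calderon.jet n).toLinearMap.range))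

/-- The canonical identification of `𝒵_n` with a quotient of `𝒵`. -/
def equivQuotient (n : ℕ) : Z n ≃ₗ[ℂ] Calderon ⧸ (Calderon.jet n).toLinearMap.ker :=
  ((Calderon.jet n).toLinearMap.quotKerEquivRange).symm

/-- `𝒵_n` carries the quotient norm. -/
instance (n : ℕ) : NormedAddCommGroup (Z n) :=
  NormedAddCommGroup.induced (Z n) _ (equivQuotient n).toLinearMap (equivQuotient n).injective

instance (n : ℕ) : NormedSpace ℂ (Z n) :=
  NormedSpace.induced ℂ (Z n) _ (equivQuotient n).toLinearMap

theorem equivQuotient_symm_mk (n : ℕ) (f : Calderon) :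
    ((equivQuotient n).symm (Submodule.Quotient.mk f)).1 = Calderon.jet n f := rfl

/-- The norm of `w` in `𝒵_n` is the infimum of the norms of the functions in `𝒵` whose first `n`
Taylor coefficients at `1/2` are given by `w`. -/
theorem norm_isGLB (n : ℕ) (w : Z n) :
    IsGLB {r : ℝ | ∃ f : Calderon, Calderon.jet n f = w.1 ∧ ‖f‖ = r} ‖w‖ := by
  have key : ∀ f : Calderon, Calderon.jet n f = w.1 ↔
      Submodule.Quotient.mk f = equivQuotient n w := fun f => by
    rw [← LinearEquiv.symm_apply_eq, ← equivQuotient_symm_mk]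
    exact ⟨fun h => Subtype.ext h, fun h => congrArg Subtype.val h⟩
  have hn : ‖w‖ = ‖equivQuotient n w‖ := rfl
  constructor
  · rintro r ⟨f, hf, rfl⟩
    rw [hn, ← (key f).1 hf]
    exact Submodule.Quotient.norm_mk_le _ f
  · intro r hr
    refine le_of_forall_pos_le_add fun ε hε => ?_
    obtain ⟨f, hf, hlt⟩ := Submodule.Quotient.norm_mk_lt (equivQuotient n w) hε
    exact (hr ⟨f, (key f).2 hf, rfl⟩).trans (hn ▸ hlt.le)

end Z

end Rochberg

end

open Filter Topology Asymptotics

/-! The spaces are told apart by the growth of signed sums of `N` bounded vectors. In `𝒵_m` the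
average over all signs of `‖∑ ε_l w_l‖` is `O(√N (log N)^(m-1))` (`Z.exists_sum_norm_le`). In
`𝒵_(n+k)` the jets of the constant functions `e_l` satisfy `‖∑ ε_l e_l‖ ≥ c √N (log N)^(n+k-1)` for
every choice of signs (`le_norm_of_toZ_eq`). An isomorphism onto `𝒵_n ⊕ 𝒵_k` would bound the same
sums by the exponent `max n k - 1 ≤ n + k - 2`, which fails for large `N`.

Lower bound: pair a representative `f` with the signs and multiply by `N^(z-1)`. The resulting
scalar function is bounded by `‖f‖` on the strip and agrees with `N^z` at `1/2` to the relevant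
order, so Cauchy's estimate for one derivative gives the claim.

Upper bound, by induction on `m`: a function in the unit ball is `2 g + φ f'`, where `g` has
coordinates `y_k V_k^(2z-1)` with `V` in the ball of `ℓ_2` (`exists_eq_weighted_add_mulPhi`). Since
`φ` vanishes at `1/2`, the part `φ f'` only costs an estimate in `𝒵_(m-1)`. For signed sums of
weighted functions, all weights are replaced by a common weight `X`, and `exp ((2z-1) log (V_l /
X))` is Taylor expanded. The coefficients are the logarithmic moments `∑ ε_l y_l (log (V_l / X))^j`
with `j < m`. Orthogonality of the signs gives them size about `√N (log N)^j` on average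
(`exists_sum_norm_toZ_weighted_le`, through `norm_toZ_le_of_log_moments`). -/

/-- An analytic function is `O((z - c) ^ m)` at `c` iff its derivatives of order less than `m`
vanish at `c`. -/
theorem AnalyticAt.isBigO_pow_iff_iteratedDeriv_eq_zero {E : Type*} [NormedAddCommGroup E]
    [NormedSpace ℂ E] [CompleteSpace E] {f : ℂ → E} {c : ℂ} (hf : AnalyticAt ℂ f c) (m : ℕ) :
    (f =O[𝓝 c] fun z => (z - c) ^ m) ↔ ∀ i < m, iteratedDeriv i f c = 0 := by
  rw [← natCast_le_analyticOrderAt_iff_iteratedDeriv_eq_zero hf]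
  constructor
  · intro h
    by_contra! hlt
    obtain ⟨n, hn⟩ := ENat.ne_top_iff_exists.1 hlt.ne_top
    rw [← hn, Nat.cast_lt] at hlt
    -- If the order were `n < m`, then cancelling `(z - c)^n` would leave `g = O(z - c)`, against `g
    -- c ≠ 0`.
    obtain ⟨g, hg, hg0, hfg⟩ := hf.analyticOrderAt_eq_natCast.1 hn.symm
    have h1 : g =O[𝓝[≠] c] fun z => z - c := by
      obtain ⟨C, hC⟩ := (h.mono nhdsWithin_le_nhds : f =O[𝓝[≠] c] fun z => (z - c) ^ m).bound
      refine IsBigO.of_bound C ?_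
      have hball : ∀ᶠ z in 𝓝[≠] c, ‖z - c‖ ≤ 1 := by
        refine nhdsWithin_le_nhds ?_
        filter_upwards [Metric.ball_mem_nhds c one_pos] with z hz
        exact (mem_ball_iff_norm.1 hz).le
      filter_upwards [hC, nhdsWithin_le_nhds hfg, hball, self_mem_nhdsWithin] with z h1 h2 h3 h4
      have hpos : 0 < ‖z - c‖ := norm_pos_iff.2 (sub_ne_zero.2 h4)
      rw [h2, norm_smul, norm_pow, norm_pow] at h1
      have hC0 : 0 ≤ C := by
        by_contra! hC0
        have : 0 ≤ C * ‖z - c‖ ^ m := le_trans (by positivity) h1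
        exact absurd this (not_le.2 (mul_neg_of_neg_of_pos hC0 (by positivity)))
      have h5 : ‖z - c‖ ^ m ≤ ‖z - c‖ ^ (n + 1) := pow_le_pow_of_le_one hpos.le h3 hlt
      have h6 : ‖z - c‖ ^ n * ‖g z‖ ≤ ‖z - c‖ ^ n * (C * ‖z - c‖) := by
        refine h1.trans ((mul_le_mul_of_nonneg_left h5 hC0).trans (le_of_eq ?_))
        ring
      exact le_of_mul_le_mul_left h6 (by positivity)
    have h2 : Tendsto g (𝓝[≠] c) (𝓝 0) := by
      refine h1.trans_tendsto ?_
      have : Tendsto (fun z => z - c) (𝓝 c) (𝓝 (c - c)) := tendsto_id.sub_const c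
      rw [sub_self] at this
      exact this.mono_left nhdsWithin_le_nhds
    exact hg0 (tendsto_nhds_unique (hg.continuousAt.tendsto.mono_left nhdsWithin_le_nhds) h2)
  · intro h
    obtain ⟨g, hg, hfg⟩ := (natCast_le_analyticOrderAt hf).1 h
    refine IsBigO.congr' (f₁ := fun z => (z - c) ^ m • g z) ?_ (hfg.mono fun z hz => hz.symm)
      EventuallyEq.rfl
    simpa using (isBigO_refl (fun z => (z - c) ^ m) (𝓝 c)).smul (hg.continuousAt.isBigO_one ℂ)

/-! ### Jets, the three lines theorem and membership in the Calderón space -/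

namespace Rochberg

theorem closure_strip : closure strip = closedStrip := by
  rw [strip, Complex.closure_preimage_re, closure_Ioo (by norm_num), closedStrip]

namespace Calderon

theorem analyticAt (f : Calderon) : AnalyticAt ℂ f (1 / 2) :=
  f.isCalderon.diffContOnCl.differentiableOn.analyticAt (isOpen_strip.mem_nhds half_mem)

theorem analyticAt_coord (f : Calderon) (k : ℕ) : AnalyticAt ℂ (fun z => f z k) (1 / 2) :=
  ((lp.evalCLM ℂ (fun _ : ℕ => ℂ) ∞ k).analyticAt _).comp f.analyticAt

theorem iteratedDeriv_coord (f : Calderon) (i k : ℕ) :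
    iteratedDeriv i (fun z => f z k) (1 / 2) = iteratedDeriv i f (1 / 2) k := by
  rw [iteratedDeriv_eq_iteratedFDeriv, iteratedDeriv_eq_iteratedFDeriv]
  have := (lp.evalCLM ℂ (fun _ : ℕ => ℂ) ∞ k).iteratedFDeriv_comp_left (f.contDiffAt i) le_rfl
  exact congrArg (fun u => u fun _ => (1 : ℂ)) this

/-- The element of `𝒵_m` given by the first `m` Taylor coefficients of a function at `1/2`. -/
noncomputable def toZ (m : ℕ) : Calderon →ₗ[ℂ] Z m := (jet m).toLinearMap.rangeRestrict

theorem coe_toZ (m : ℕ) (f : Calderon) : (toZ m f).1 = jet m f := rfl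

theorem norm_toZ_le (m : ℕ) (f : Calderon) : ‖toZ m f‖ ≤ ‖f‖ :=
  (Z.norm_isGLB m (toZ m f)).1 ⟨f, rfl, rfl⟩

theorem exists_toZ_eq {m : ℕ} (w : Z m) {r : ℝ} (hr : ‖w‖ < r) :
    ∃ f : Calderon, toZ m f = w ∧ ‖f‖ < r := by
  obtain ⟨_, ⟨f, hf, rfl⟩, -, h⟩ := (Z.norm_isGLB m w).exists_between hr
  exact ⟨f, Subtype.ext hf, h⟩

/-- Derivatives commute with coordinate evaluations, so equality of jets reduces to scalar
estimates. No uniformity in `k` is needed, because norms are never compared this way. -/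
theorem toZ_eq_zero_iff (m : ℕ) (f : Calderon) :
    toZ m f = 0 ↔ ∀ k, (fun z => f z k) =O[𝓝 (1 / 2)] fun z => (z - 1 / 2) ^ m := by
  simp only [fun k => (f.analyticAt_coord k).isBigO_pow_iff_iteratedDeriv_eq_zero m,
    iteratedDeriv_coord]
  constructor
  · intro h k i hi
    have h1 : jet m f ⟨i, hi⟩ = 0 := congrFun (congrArg Subtype.val h) ⟨i, hi⟩
    have h2 : ((i.factorial : ℂ))⁻¹ * iteratedDeriv i f (1 / 2) k = 0 :=
      congrArg (fun x : LInf => x k) h1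
    simpa [Nat.factorial_ne_zero] using h2
  · intro h
    refine Subtype.ext (funext fun i => ?_)
    rw [coe_toZ, jet_apply]
    have h1 : iteratedDeriv i f (1 / 2) = 0 := by
      ext k
      exact h k i i.2
    rw [h1, smul_zero]
    rfl

theorem toZ_eq_of_isBigO {m : ℕ} {f g : Calderon}
    (h : ∀ k, (fun z => f z k - g z k) =O[𝓝 (1 / 2)] fun z => (z - 1 / 2) ^ m) :
    toZ m f = toZ m g := by
  rw [← sub_eq_zero, ← map_sub, toZ_eq_zero_iff]
  exact h

end Calderon

theorem I_mul_mem_closedStrip (t : ℝ) : Complex.I * t ∈ closedStrip := by simp [closedStrip]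

theorem one_add_I_mul_mem_closedStrip (t : ℝ) : 1 + Complex.I * t ∈ closedStrip := by
  simp [closedStrip]

theorem half_mem_closedStrip : (1 / 2 : ℂ) ∈ closedStrip :=
  closure_strip ▸ subset_closure Calderon.half_mem

/-- The three lines theorem for bounded functions on the unit strip. -/
theorem norm_le_of_boundary {f : ℂ → ℂ} (hf : DiffContOnCl ℂ f strip) {C M : ℝ}
    (hC : ∀ z ∈ closedStrip, ‖f z‖ ≤ C) (h0 : ∀ t : ℝ, ‖f (Complex.I * t)‖ ≤ M)
    (h1 : ∀ t : ℝ, ‖f (1 + Complex.I * t)‖ ≤ M) {z : ℂ} (hz : z ∈ closedStrip) : ‖f z‖ ≤ M := by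
  refine PhragmenLindelof.vertical_strip (a := 0) (b := 1) hf
    ⟨0, by positivity, 0, ?_⟩ (fun w hw => ?_) (fun w hw => ?_) hz.1 hz.2
  · refine IsBigO.of_bound C (mem_inf_of_right fun w hw => ?_)
    simpa using hC w ⟨hw.1.le, hw.2.le⟩
  · have hw' : w = Complex.I * w.im := by apply Complex.ext <;> simp [hw]
    exact hw' ▸ h0 w.im
  · have hw' : w = 1 + Complex.I * w.im := by apply Complex.ext <;> simp [hw]
    exact hw' ▸ h1 w.im

namespace Calderon

theorem norm_coord_le (f : Calderon) (z : ℂ) (k : ℕ) : ‖f z k‖ ≤ ‖f‖ :=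
  (lp.norm_apply_le_norm (by simp) (f z) k).trans (f.norm_apply_le z)

theorem sum_norm_right_le (f : Calderon) (t : ℝ) (s : Finset ℕ) :
    ∑ k ∈ s, ‖f (1 + Complex.I * t) k‖ ≤ ‖f‖ := by
  have h := lp.sum_rpow_le_norm_rpow (p := 1) (by simp) (f.right t) s
  simp only [ENNReal.toReal_one, Real.rpow_one, right_apply] at h
  exact h.trans ((f.right.norm_coe_le_norm t).trans (norm_def f ▸ le_max_right _ _))

theorem norm_le_of_forall (f : Calderon) {M : ℝ} (hM : 0 ≤ M)
    (h0 : ∀ (t : ℝ) (k : ℕ), ‖f (Complex.I * t) k‖ ≤ M)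
    (h1 : ∀ (t : ℝ) (s : Finset ℕ), ∑ k ∈ s, ‖f (1 + Complex.I * t) k‖ ≤ M) : ‖f‖ ≤ M := by
  rw [norm_def]
  refine max_le ((BoundedContinuousFunction.norm_le hM).2 fun t => ?_)
    ((BoundedContinuousFunction.norm_le hM).2 fun t => ?_)
  · exact lp.norm_le_of_forall_le hM (h0 t)
  · refine lp.norm_le_of_forall_sum_le (by simp) hM fun s => ?_
    simpa [right_apply] using h1 t s

/-- A function on the closed strip as an element of the Calderón space. -/
noncomputable def ofFun (G : ℂ → LInf) (hd : DiffContOnCl ℂ G strip)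
    (hb : ∃ C : ℝ, ∀ z ∈ closedStrip, ‖G z‖ ≤ C) (g : ℝ →ᵇ LOne)
    (hg : ∀ (t : ℝ) (k : ℕ), g t k = G (1 + Complex.I * t) k) : Calderon :=
  ⟨closedStrip.indicator G, by
    have heq : Set.EqOn (closedStrip.indicator G) G closedStrip := Set.eqOn_indicator
    refine ⟨⟨hd.differentiableOn.congr fun z hz => heq ?_, ?_⟩, ?_, ⟨g, fun t k => ?_⟩,
      fun z hz => Set.indicator_of_notMem hz _⟩
    · exact closure_strip ▸ subset_closure hz
    · rw [closure_strip]
      exact (closure_strip ▸ hd.continuousOn).congr heq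
    · obtain ⟨C, hC⟩ := hb
      exact ⟨C, fun z hz => by rw [heq hz]; exact hC z hz⟩
    · rw [heq (one_add_I_mul_mem_closedStrip t), hg]⟩

theorem ofFun_apply {G : ℂ → LInf} (hd : DiffContOnCl ℂ G strip)
    (hb : ∃ C : ℝ, ∀ z ∈ closedStrip, ‖G z‖ ≤ C) (g : ℝ →ᵇ LOne)
    (hg : ∀ (t : ℝ) (k : ℕ), g t k = G (1 + Complex.I * t) k) {z : ℂ} (hz : z ∈ closedStrip) :
    ofFun G hd hb g hg z = G z :=
  Set.indicator_of_mem hz _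

/-- A function on the closed strip which is a bounded continuous multiple of an element of the
Calderón space on the boundary belongs to the Calderón space. -/
theorem exists_eq_of_boundary (f : Calderon) {G : ℂ → LInf} (hd : DiffContOnCl ℂ G strip)
    (hb : ∃ C : ℝ, ∀ z ∈ closedStrip, ‖G z‖ ≤ C) {ψ : ℂ → ℂ} {M : ℝ}
    (hψ : Continuous fun t : ℝ => ψ (1 + Complex.I * t))
    (h0 : ∀ t : ℝ, ‖ψ (Complex.I * t)‖ ≤ M) (h1 : ∀ t : ℝ, ‖ψ (1 + Complex.I * t)‖ ≤ M)
    (e0 : ∀ t : ℝ, G (Complex.I * t) = ψ (Complex.I * t) • f (Complex.I * t))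
    (e1 : ∀ t : ℝ, G (1 + Complex.I * t) = ψ (1 + Complex.I * t) • f (1 + Complex.I * t)) :
    ∃ F : Calderon, (∀ z ∈ closedStrip, F z = G z) ∧ ‖F‖ ≤ M * ‖f‖ := by
  have hM : 0 ≤ M := (norm_nonneg _).trans (h0 0)
  -- Only the boundary values of `ψ` enter, so `ψ` may have a pole inside the strip, as it does in
  -- the division by `phi`.
  let g : ℝ →ᵇ LOne := BoundedContinuousFunction.ofNormedAddCommGroup
    (fun t => ψ (1 + Complex.I * t) • f.right t) (hψ.smul f.right.continuous) (M * ‖f.right‖)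
    (fun t => by
      rw [norm_smul]
      exact mul_le_mul (h1 t) (f.right.norm_coe_le_norm t) (norm_nonneg _) hM)
  have hg : ∀ (t : ℝ) (k : ℕ), g t k = G (1 + Complex.I * t) k := fun t k => by
    rw [e1]
    change ψ (1 + Complex.I * t) * f.right t k = ψ (1 + Complex.I * t) * f (1 + Complex.I * t) k
    rw [right_apply]
  refine ⟨ofFun G hd hb g hg, fun z hz => ofFun_apply hd hb g hg hz,
    norm_le_of_forall _ (by positivity) (fun t k => ?_) (fun t s => ?_)⟩
  · rw [ofFun_apply hd hb g hg (I_mul_mem_closedStrip t), e0]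
    change ‖ψ (Complex.I * t) * f (Complex.I * t) k‖ ≤ _
    rw [norm_mul]
    exact mul_le_mul (h0 t) (f.norm_coord_le _ k) (norm_nonneg _) hM
  · rw [ofFun_apply hd hb g hg (one_add_I_mul_mem_closedStrip t), e1]
    change ∑ k ∈ s, ‖ψ (1 + Complex.I * t) * f (1 + Complex.I * t) k‖ ≤ _
    simp only [norm_mul, ← Finset.mul_sum]
    exact mul_le_mul (h1 t) (f.sum_norm_right_le t s) (by positivity) hM

end Calderon

/-! ### Multiplication and division by a function vanishing at `1/2` -/

/-- The function `(z - 1/2) / (z + 1)`, which is bounded by one on the strip and vanishes only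
at `1/2`. -/
noncomputable def phi (z : ℂ) : ℂ := (z - 1 / 2) / (z + 1)

theorem add_one_ne_zero_of_mem {z : ℂ} (hz : z ∈ closedStrip) : z + 1 ≠ 0 := by
  intro h
  have h1 := congrArg Complex.re h
  have h2 : 0 ≤ z.re := hz.1
  simp only [Complex.add_re, Complex.one_re, Complex.zero_re] at h1
  linarith

/-- Points with nonnegative real part are closer to `1/2` than to `-1`. -/
theorem norm_phi_le {z : ℂ} (hz : z ∈ closedStrip) : ‖phi z‖ ≤ 1 := by
  rw [phi, norm_div]
  refine div_le_one_of_le₀ ?_ (norm_nonneg _)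
  rw [← sq_le_sq₀ (norm_nonneg _) (norm_nonneg _), Complex.sq_norm, Complex.sq_norm,
    Complex.normSq_apply, Complex.normSq_apply]
  have h : 0 ≤ z.re := hz.1
  simp
  norm_num
  nlinarith

theorem diffContOnCl_phi : DiffContOnCl ℂ phi strip := by
  refine DifferentiableOn.diffContOnCl fun z hz => ?_
  rw [closure_strip] at hz
  have h1 : DifferentiableAt ℂ (fun z : ℂ => z - 1 / 2) z := by fun_prop
  have h2 : DifferentiableAt ℂ (fun z : ℂ => z + 1) z := by fun_prop
  exact (h1.div h2 (add_one_ne_zero_of_mem hz)).differentiableWithinAt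

namespace Calderon

/-- Multiplication by `phi` on the Calderón space. -/
noncomputable def mulPhi : Calderon →ₗ[ℂ] Calderon where
  toFun f := ⟨fun z => phi z • f z, by
    have hd : DiffContOnCl ℂ (fun z => phi z • f z) strip :=
      diffContOnCl_phi.smul f.isCalderon.diffContOnCl
    obtain ⟨F, hF, -⟩ := f.exists_eq_of_boundary hd
      ⟨1 * ‖f‖, fun z hz => by
        rw [norm_smul]
        exact mul_le_mul (norm_phi_le hz) (f.norm_apply_le z) (norm_nonneg _) zero_le_one⟩
      (ψ := phi) (M := 1)
      ((closure_strip ▸ diffContOnCl_phi.continuousOn).comp_continuous (by fun_prop)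
        one_add_I_mul_mem_closedStrip)
      (fun t => norm_phi_le (I_mul_mem_closedStrip t))
      (fun t => norm_phi_le (one_add_I_mul_mem_closedStrip t)) (fun t => rfl) (fun t => rfl)
    have h : (fun z => phi z • f z) = F := by
      funext z
      by_cases hz : z ∈ closedStrip
      · exact (hF z hz).symm
      · rw [f.isCalderon.eq_zero z hz, F.isCalderon.eq_zero z hz, smul_zero]
    rw [h]
    exact F.2⟩
  map_add' f g := by
    ext1 z
    exact smul_add (phi z) (f z) (g z)
  map_smul' c f := by
    ext1 z
    exact smul_comm (phi z) c (f z)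

theorem mulPhi_apply (f : Calderon) (z : ℂ) : mulPhi f z = phi z • f z := rfl

theorem mulPhi_coord (f : Calderon) (z : ℂ) (k : ℕ) : mulPhi f z k = phi z * f z k := rfl

theorem norm_mulPhi_le (f : Calderon) : ‖mulPhi f‖ ≤ ‖f‖ := by
  refine norm_le_of_forall _ (norm_nonneg _) (fun t k => ?_) (fun t s => ?_)
  · rw [mulPhi_coord, norm_mul]
    exact (mul_le_of_le_one_left (norm_nonneg _) (norm_phi_le (I_mul_mem_closedStrip t))).trans
      (f.norm_coord_le _ k)
  · refine (Finset.sum_le_sum fun k _ => ?_).trans (f.sum_norm_right_le t s)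
    rw [mulPhi_coord, norm_mul]
    exact mul_le_of_le_one_left (norm_nonneg _) (norm_phi_le (one_add_I_mul_mem_closedStrip t))

/-- A function in the Calderón space that vanishes at `1/2` is divisible by `phi`. -/
theorem exists_mulPhi_eq (f : Calderon) (hf : f (1 / 2) = 0) :
    ∃ g : Calderon, mulPhi g = f ∧ ‖g‖ ≤ 4 * ‖f‖ := by
  -- The divided difference fills in the removable singularity of `f / phi`.
  let G : ℂ → LInf := fun z => (z + 1) • dslope f (1 / 2) z
  have hG : ∀ z ≠ 1 / 2, G z = ((z + 1) / (z - 1 / 2)) • f z := fun z hz => by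
    simp only [G]
    rw [dslope_of_ne _ hz, slope_def_module, hf, sub_zero, smul_smul, ← div_eq_mul_inv]
  have hnhds : strip ∈ 𝓝 (1 / 2 : ℂ) := isOpen_strip.mem_nhds half_mem
  have hcont : ContinuousOn (dslope f (1 / 2)) closedStrip :=
    (continuousOn_dslope (mem_of_superset hnhds (closure_strip ▸ subset_closure))).2
      ⟨f.continuousOn, f.analyticAt.differentiableAt⟩
  have hcontG : ContinuousOn G closedStrip := (continuousOn_id.add continuousOn_const).smul hcont
  have hd : DiffContOnCl ℂ G strip := by
    refine ⟨(differentiableOn_id.add_const _).smul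
      ((Complex.differentiableOn_dslope hnhds).2 f.isCalderon.diffContOnCl.differentiableOn), ?_⟩
    rw [closure_strip]
    exact hcontG
  -- On the boundary lines `r = 1/2` gives the constant 4. Off the disc of radius `1/4` it gives 7,
  -- used only for qualitative boundedness.
  have hnorm : ∀ (z : ℂ) (r : ℝ), 0 < r → r ≤ ‖z - 1 / 2‖ →
      ‖(z + 1) / (z - 1 / 2)‖ ≤ 1 + 3 / 2 / r := fun z r hr hz => by
    have h1 : ‖z + 1‖ ≤ ‖z - 1 / 2‖ + 3 / 2 := by
      have := norm_add_le (z - 1 / 2) (3 / 2)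
      have h3 : ‖(3 / 2 : ℂ)‖ = 3 / 2 := by norm_num
      rw [h3] at this
      refine le_trans (le_of_eq ?_) this
      congr 1
      ring
    have hpos : 0 < ‖z - 1 / 2‖ := hr.trans_le hz
    rw [norm_div, div_le_iff₀ hpos]
    have h2 : 3 / 2 / r * r ≤ 3 / 2 / r * ‖z - 1 / 2‖ :=
      mul_le_mul_of_nonneg_left hz (by positivity)
    rw [div_mul_cancel₀ _ hr.ne'] at h2
    linarith
  have hfar : ∀ (z : ℂ), |z.re - 1 / 2| = 1 / 2 → 1 / 2 ≤ ‖z - 1 / 2‖ := fun z hz => by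
    have := Complex.abs_re_le_norm (z - 1 / 2)
    have h2 : (z - 1 / 2).re = z.re - 1 / 2 := by simp
    rwa [h2, hz] at this
  have hfar0 : ∀ t : ℝ, 1 / 2 ≤ ‖Complex.I * t - 1 / 2‖ := fun t => hfar _ (by simp)
  have hfar1 : ∀ t : ℝ, 1 / 2 ≤ ‖1 + Complex.I * t - 1 / 2‖ := fun t => hfar _ (by norm_num)
  have hne : ∀ z : ℂ, 1 / 2 ≤ ‖z - 1 / 2‖ → z ≠ 1 / 2 := by
    rintro z hz rfl
    norm_num at hz
  have hsub : Metric.closedBall (1 / 2 : ℂ) (1 / 4) ⊆ closedStrip := fun z hz => by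
    have h1 : |(z - 1 / 2).re| ≤ 1 / 4 :=
      (Complex.abs_re_le_norm _).trans (by simpa [dist_eq_norm] using hz)
    have h2 : (z - 1 / 2).re = z.re - 1 / 2 := by simp
    rw [h2, abs_le] at h1
    exact ⟨by linarith, by linarith⟩
  obtain ⟨C, hC⟩ := (isCompact_closedBall (1 / 2 : ℂ) (1 / 4)).exists_bound_of_continuousOn
    (hcontG.mono hsub)
  obtain ⟨F, hF, hFn⟩ := f.exists_eq_of_boundary hd
    ⟨max C (7 * ‖f‖), fun z _ => by
      by_cases hz : z ∈ Metric.closedBall (1 / 2 : ℂ) (1 / 4)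
      · exact (hC z hz).trans (le_max_left _ _)
      · rw [Metric.mem_closedBall, not_le, dist_eq_norm] at hz
        have hz2 : z ≠ 1 / 2 := by
          rintro rfl
          norm_num at hz
        rw [hG z hz2, norm_smul]
        refine le_trans (mul_le_mul ((hnorm z _ (by norm_num) hz.le).trans ?_)
          (f.norm_apply_le z) (norm_nonneg _) (by norm_num : (0 : ℝ) ≤ 7)) (le_max_right _ _)
        norm_num⟩
    (ψ := fun z => (z + 1) / (z - 1 / 2)) (M := 4)
    (Continuous.div (by fun_prop) (by fun_prop) fun t => sub_ne_zero.2 (hne _ (hfar1 t)))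
    (fun t => (hnorm _ _ (by norm_num) (hfar0 t)).trans (by norm_num))
    (fun t => (hnorm _ _ (by norm_num) (hfar1 t)).trans (by norm_num))
    (fun t => hG _ (hne _ (hfar0 t))) (fun t => hG _ (hne _ (hfar1 t)))
  refine ⟨F, ?_, hFn⟩
  ext1 z
  by_cases hz : z ∈ closedStrip
  · rw [mulPhi_apply, hF z hz, phi, smul_smul, div_mul_cancel₀ _ (add_one_ne_zero_of_mem hz)]
    exact sub_smul_dslope_of_zero hf z
  · rw [f.isCalderon.eq_zero z hz, (mulPhi F).isCalderon.eq_zero z hz]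

end Calderon
end Rochberg

/-! ### Weighted functions and the role of `ℓ_2` at the centre of the strip -/

/-- The terms of a summable positive series may be multiplied by factors tending to infinity
without destroying the summability. -/
theorem Summable.exists_tendsto_atTop_mul_le {c : ℕ → ℝ} (hc : Summable c) (hpos : ∀ k, 0 < c k) :
    ∃ l : ℕ → ℝ, (∀ k, 1 ≤ l k) ∧ Tendsto l atTop atTop ∧
      ∀ s : Finset ℕ, ∑ k ∈ s, l k ^ 2 * c k ≤ 2 * ∑' k, c k := by
  set r : ℕ → ℝ := fun n => ∑' k, c (k + n) with hr
  have hs : ∀ n, Summable fun k => c (k + n) := fun n => (summable_nat_add_iff n).2 hc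
  have hrec : ∀ n, r n = c n + r (n + 1) := fun n => by
    have h := (hs n).tsum_eq_zero_add
    simp only [zero_add] at h
    rw [hr]
    simp only [h]
    congr 2
    funext k
    congr 1
    ring
  have hrpos : ∀ n, 0 < r n := fun n => (hs n).tsum_pos (fun k => (hpos _).le) 0 (hpos _)
  have hr0 : r 0 = ∑' k, c k := rfl
  have hanti : Antitone r := antitone_nat_of_succ_le fun n => by
    rw [hrec n]
    linarith [hpos n]
  have hlim : Tendsto r atTop (𝓝 0) := tendsto_sum_nat_add c
  have hsq : ∀ n, √(√(r 0 / r n)) ^ 2 = √(r 0) / √(r n) := fun n => by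
    rw [Real.sq_sqrt (Real.sqrt_nonneg _), Real.sqrt_div (hrpos 0).le]
  -- With `r` the tails, the square of the factor is `√(r 0) / √(r n)`, and `(r n - r (n+1)) / √(r
  -- n) ≤ 2 (√(r n) - √(r (n+1)))` telescopes.
  refine ⟨fun n => √(√(r 0 / r n)), fun n => ?_, ?_, fun s => ?_⟩
  · rw [Real.one_le_sqrt, Real.one_le_sqrt, one_le_div (hrpos n)]
    exact hanti n.zero_le
  · refine Real.tendsto_sqrt_atTop.comp (Real.tendsto_sqrt_atTop.comp ?_)
    have h1 : Tendsto (fun n => (r n)⁻¹) atTop atTop :=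
      tendsto_inv_nhdsGT_zero.comp
        (tendsto_nhdsWithin_iff.2 ⟨hlim, Eventually.of_forall fun n => hrpos n⟩)
    exact h1.const_mul_atTop (hrpos 0)
  · simp only [hsq]
    have hterm : ∀ n, √(r 0) / √(r n) * c n ≤ 2 * √(r 0) * (√(r n) - √(r (n + 1))) := fun n => by
      have hcn : c n = (√(r n) - √(r (n + 1))) * (√(r n) + √(r (n + 1))) := by
        have h1 := Real.mul_self_sqrt (hrpos n).le
        have h2 := Real.mul_self_sqrt (hrpos (n + 1)).le
        linear_combination -hrec n + h2 - h1
      have hle : √(r (n + 1)) ≤ √(r n) := Real.sqrt_le_sqrt (hanti n.le_succ)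
      have hp : 0 < √(r n) := Real.sqrt_pos.2 (hrpos n)
      rw [div_mul_eq_mul_div, div_le_iff₀ hp, hcn]
      have : √(r 0) * (√(r n) - √(r (n + 1))) * (√(r n) + √(r (n + 1))) ≤
          √(r 0) * (√(r n) - √(r (n + 1))) * (√(r n) + √(r n)) :=
        mul_le_mul_of_nonneg_left (by linarith)
          (mul_nonneg (Real.sqrt_nonneg _) (sub_nonneg.2 hle))
      linarith
    have hnn : ∀ n, 0 ≤ √(r 0) / √(r n) * c n := fun n => mul_nonneg (by positivity) (hpos n).le
    obtain ⟨m, hm⟩ := s.exists_nat_subset_range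
    refine (Finset.sum_le_sum_of_subset_of_nonneg hm fun i _ _ => hnn i).trans
      ((Finset.sum_le_sum fun n _ => hterm n).trans ?_)
    rw [← Finset.mul_sum, Finset.sum_range_sub', ← hr0]
    have h1 := Real.mul_self_sqrt (hrpos 0).le
    have h2 : 0 ≤ √(r 0) * √(r m) := by positivity
    nlinarith

namespace Rochberg

theorem norm_exp_two_mul_sub_one (z : ℂ) (x : ℝ) :
    ‖Complex.exp ((2 * z - 1) * x)‖ = Real.exp ((2 * z.re - 1) * x) := by
  rw [Complex.norm_exp]
  simp

/-- Write `V^(2x-1) = (V^2)^x / V`; for `0 ≤ x ≤ 1` the numerator is at most `max 1 (V^2)`. -/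
theorem exp_log_mul_le {V : ℝ} (hV : 0 < V) {x B : ℝ} (h0 : 0 ≤ x) (h1 : x ≤ 1) (hB : V ^ 2 ≤ B) :
    Real.exp ((2 * x - 1) * Real.log V) ≤ max 1 B / V := by
  have h2 : (2 * x - 1) * Real.log V = x * Real.log (V ^ 2) - Real.log V := by
    rw [Real.log_pow]
    push_cast
    ring
  rw [h2, Real.exp_sub, Real.exp_log hV]
  refine div_le_div_of_nonneg_right ?_ hV.le
  rcases le_total (Real.log (V ^ 2)) 0 with h | h
  · exact (Real.exp_le_one_iff.2 (mul_nonpos_of_nonneg_of_nonpos h0 h)).trans (le_max_left _ _)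
  · refine le_trans ?_ (hB.trans (le_max_right _ _))
    calc Real.exp (x * Real.log (V ^ 2)) ≤ Real.exp (Real.log (V ^ 2)) :=
          Real.exp_le_exp.2 (mul_le_of_le_one_left h h1)
      _ = V ^ 2 := Real.exp_log (by positivity)

namespace Calderon

/-- The function with coordinates `y_k V_k ^ (2 z - 1)` belongs to the Calderón space if `V` is in
the ball of `ℓ_2` and `y_k / V_k` tends to zero. -/
theorem exists_weighted {V : ℕ → ℝ} {y : ℕ → ℂ} {M B : ℝ} (hV : ∀ k, 0 < V k) (hM : 0 ≤ M)
    (hy : ∀ k, ‖y k‖ ≤ M * V k) (hlim : Tendsto (fun k => ‖y k‖ / V k) atTop (𝓝 0))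
    (hB : ∀ s : Finset ℕ, ∑ k ∈ s, V k ^ 2 ≤ B) :
    ∃ f : Calderon, (∀ z ∈ closedStrip, ∀ k,
      f z k = y k * Complex.exp ((2 * z - 1) * (Real.log (V k) : ℝ))) ∧ ‖f‖ ≤ M * max 1 B := by
  set a : ℕ → ℂ → ℂ := fun k z => y k * Complex.exp ((2 * z - 1) * (Real.log (V k) : ℝ)) with ha
  have hVB : ∀ k, V k ^ 2 ≤ B := fun k => by simpa using hB {k}
  have hB1 : 0 < max 1 B := lt_max_of_lt_left one_pos
  have hbound : ∀ z ∈ closedStrip, ∀ k, ‖a k z‖ ≤ ‖y k‖ / V k * max 1 B := fun z hz k => by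
    simp only [ha]
    rw [norm_mul, norm_exp_two_mul_sub_one, div_mul_eq_mul_div, mul_div_assoc]
    exact mul_le_mul_of_nonneg_left (exp_log_mul_le (hV k) hz.1 hz.2 (hVB k)) (norm_nonneg _)
  have hyV : ∀ k, ‖y k‖ / V k ≤ M := fun k => (div_le_iff₀ (hV k)).2 (hy k)
  have hbound' : ∀ z ∈ closedStrip, ∀ k, ‖a k z‖ ≤ M * max 1 B := fun z hz k =>
    (hbound z hz k).trans (mul_le_mul_of_nonneg_right (hyV k) hB1.le)
  have hmem : ∀ z ∈ closedStrip, Memℓp (fun k => a k z) ∞ := fun z hz =>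
    memℓp_infty ⟨M * max 1 B, by rintro _ ⟨k, rfl⟩; exact hbound' z hz k⟩
  classical
  let G : ℂ → LInf := fun z => if h : z ∈ closedStrip then ⟨fun k => a k z, hmem z h⟩ else 0
  have hG : ∀ z ∈ closedStrip, ∀ k, G z k = a k z := fun z hz k => by
    simp only [G, dif_pos hz]
  let F : ℕ → ℂ → LInf := fun n z =>
    ∑ k ∈ Finset.range n, lp.singleContinuousLinearMap ℂ (fun _ : ℕ => ℂ) ∞ k (a k z)
  have hFk : ∀ n z k, F n z k = if k < n then a k z else 0 := fun n z k => by
    simp only [F, lp.coeFn_sum, Finset.sum_apply, lp.singleContinuousLinearMap_apply,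
      lp.coeFn_single, Pi.single_apply, Finset.sum_ite_eq, Finset.mem_range]
  have hFd : ∀ n, Differentiable ℂ (F n) := fun n => by
    refine Differentiable.fun_sum fun k _ => ?_
    refine (ContinuousLinearMap.differentiable _).comp ?_
    simp only [ha]
    fun_prop
  -- The decay of `‖y k‖ / V k` makes the finite truncations converge uniformly in `ℓ_∞`; this is
  -- what gives analyticity and continuity in norm.
  have hunif : TendstoUniformlyOn F G atTop closedStrip := by
    rw [Metric.tendstoUniformlyOn_iff]
    intro ε hε
    have h1 : Tendsto (fun k => ‖y k‖ / V k * max 1 B) atTop (𝓝 0) := by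
      simpa using hlim.mul_const (max 1 B)
    obtain ⟨K, hK⟩ := eventually_atTop.1 (h1.eventually_lt_const (half_pos hε))
    filter_upwards [eventually_ge_atTop K] with n hn z hz
    rw [dist_eq_norm]
    refine lt_of_le_of_lt (lp.norm_le_of_forall_le (half_pos hε).le fun k => ?_) (half_lt_self hε)
    change ‖G z k - F n z k‖ ≤ _
    rw [hG z hz, hFk]
    split_ifs with h
    · simpa using (half_pos hε).le
    · rw [sub_zero]
      exact (hbound z hz k).trans (hK k (by omega)).le
  have hd : DiffContOnCl ℂ G strip := by
    refine ⟨?_, ?_⟩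
    · refine TendstoLocallyUniformlyOn.differentiableOn
        (hunif.mono (closure_strip ▸ subset_closure)).tendstoLocallyUniformlyOn
        (Eventually.of_forall fun n => (hFd n).differentiableOn) isOpen_strip
    · rw [closure_strip]
      exact hunif.continuousOn (Eventually.of_forall fun n => (hFd n).continuous.continuousOn).frequently
  have hyVs : ∀ k, ‖y k‖ * V k ≤ M * V k ^ 2 := fun k => by
    rw [pow_two, ← mul_assoc]
    exact mul_le_mul_of_nonneg_right (hy k) (hV k).le
  have hsum : Summable fun k => ‖y k‖ * V k := by
    refine Summable.of_nonneg_of_le (fun k => mul_nonneg (norm_nonneg _) (hV k).le) hyVs ?_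
    exact (summable_of_sum_le (fun k => sq_nonneg (V k)) hB).mul_left M
  -- On the right edge the moduli do not depend on `t` and are dominated by `M * V k ^ 2`, so the
  -- series converges in `ℓ_1` uniformly in `t`.
  have haR : ∀ (t : ℝ) k, ‖a k (1 + Complex.I * t)‖ = ‖y k‖ * V k := fun t k => by
    simp only [ha]
    rw [norm_mul, norm_exp_two_mul_sub_one]
    simp
    norm_num [Real.exp_log (hV k)]
  have hsing : ∀ (t : ℝ) k, ‖lp.singleContinuousLinearMap ℂ (fun _ : ℕ => ℂ) 1 k
      (a k (1 + Complex.I * t))‖ ≤ ‖y k‖ * V k := fun t k => by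
    rw [lp.singleContinuousLinearMap_apply, lp.norm_single (by simp), haR]
  let g : ℝ →ᵇ LOne := BoundedContinuousFunction.ofNormedAddCommGroup
    (fun t => ∑' k, lp.singleContinuousLinearMap ℂ (fun _ : ℕ => ℂ) 1 k (a k (1 + Complex.I * t)))
    (continuous_tsum (fun k => (ContinuousLinearMap.continuous _).comp (by simp only [ha]; fun_prop))
      hsum fun k t => hsing t k) (∑' k, ‖y k‖ * V k)
    (fun t => tsum_of_norm_bounded hsum.hasSum (hsing t))
  have hgk : ∀ (t : ℝ) k, g t k = a k (1 + Complex.I * t) := fun t k => by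
    have hs : Summable fun k => lp.singleContinuousLinearMap ℂ (fun _ : ℕ => ℂ) 1 k
      (a k (1 + Complex.I * t)) := Summable.of_norm_bounded hsum (hsing t)
    have h1 := (lp.evalCLM ℂ (fun _ : ℕ => ℂ) 1 k).map_tsum hs
    refine h1.trans ?_
    rw [tsum_eq_single k]
    · exact lp.single_apply_self 1 k _
    · intro j hj
      exact lp.single_apply_ne 1 j _ hj.symm
  have hg : ∀ (t : ℝ) (k : ℕ), g t k = G (1 + Complex.I * t) k := fun t k => by
    rw [hgk, hG _ (one_add_I_mul_mem_closedStrip t)]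
  have hb : ∃ C : ℝ, ∀ z ∈ closedStrip, ‖G z‖ ≤ C := ⟨M * max 1 B, fun z hz =>
    lp.norm_le_of_forall_le (by positivity) fun k => by rw [hG z hz]; exact hbound' z hz k⟩
  have hval : ∀ z ∈ closedStrip, ∀ k, ofFun G hd hb g hg z k = a k z := fun z hz k => by
    rw [ofFun_apply hd hb g hg hz, hG z hz]
  refine ⟨ofFun G hd hb g hg, hval, norm_le_of_forall _ (by positivity) (fun t k => ?_)
    fun t s => ?_⟩
  · rw [hval _ (I_mul_mem_closedStrip t)]
    exact hbound' _ (I_mul_mem_closedStrip t) k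
  · simp only [hval _ (one_add_I_mul_mem_closedStrip t), haR]
    calc ∑ k ∈ s, ‖y k‖ * V k ≤ ∑ k ∈ s, M * V k ^ 2 := Finset.sum_le_sum fun k _ => hyVs k
      _ = M * ∑ k ∈ s, V k ^ 2 := by rw [Finset.mul_sum]
      _ ≤ M * max 1 B := mul_le_mul_of_nonneg_left ((hB s).trans (le_max_right _ _)) hM

/-- The value at `1/2` of a function in the Calderón space belongs to `ℓ_2`. -/
theorem sum_sq_half_le (f : Calderon) (s : Finset ℕ) :
    ∑ k ∈ s, ‖f (1 / 2) k‖ ^ 2 ≤ ‖f‖ ^ 2 := by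
  set y : ℕ → ℂ := fun k => f (1 / 2) k with hy
  set S := ∑ k ∈ s, ‖y k‖ ^ 2 with hS
  have hS0 : 0 ≤ S := by positivity
  rcases hS0.eq_or_lt with h0 | hSpos
  · rw [← h0]
    positivity
  set A := √S with hA
  have hApos : 0 < A := Real.sqrt_pos.2 hSpos
  have hAsq : A ^ 2 = S := Real.sq_sqrt hS0
  set x : ℕ → ℝ := fun k => Real.log (‖y k‖ / A) with hx
  -- Interpolation by duality: the multipliers have modulus `(‖y k‖ / A)^(2 - 2 Re z)`, hence sum to
  -- one on the left edge and are at most one on the right edge, while `q (1/2) = A`. Where `y k =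
  -- 0` the prefactor vanishes and the default value of `log 0` is harmless.
  set q : ℂ → ℂ := fun z => ∑ k ∈ s,
    f z k * (starRingEnd ℂ (y k) / A * Complex.exp ((2 * z - 1) * (-x k : ℝ))) with hq
  have hnq : ∀ z k, ‖starRingEnd ℂ (y k) / A * Complex.exp ((2 * z - 1) * (-x k : ℝ))‖ =
      ‖y k‖ / A * Real.exp ((2 * z.re - 1) * (-x k)) := fun z k => by
    rw [norm_mul, norm_exp_two_mul_sub_one, norm_div, RCLike.norm_conj, Complex.norm_real,
      Real.norm_of_nonneg hApos.le]
  have hd : DiffContOnCl ℂ q strip := by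
    have hk : ∀ k, DiffContOnCl ℂ (fun z => f z k *
        (starRingEnd ℂ (y k) / A * Complex.exp ((2 * z - 1) * (-x k : ℝ)))) strip := fun k => by
      have h1 : DiffContOnCl ℂ (fun z => f z k) strip :=
        (lp.evalCLM ℂ (fun _ : ℕ => ℂ) ∞ k).differentiable.comp_diffContOnCl
          f.isCalderon.diffContOnCl
      have h2 : Differentiable ℂ (fun z : ℂ =>
        starRingEnd ℂ (y k) / A * Complex.exp ((2 * z - 1) * (-x k : ℝ))) := by fun_prop
      exact h1.smul h2.diffContOnCl
    refine ⟨DifferentiableOn.fun_sum fun k _ => (hk k).differentiableOn,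
      continuousOn_finsetSum _ fun k _ => (hk k).continuousOn⟩
  have hC : ∀ z ∈ closedStrip, ‖q z‖ ≤ ∑ k ∈ s, ‖f‖ * (‖y k‖ / A * Real.exp |x k|) := by
    intro z hz
    refine norm_sum_le_of_le _ fun k _ => ?_
    rw [norm_mul, hnq]
    refine mul_le_mul (f.norm_coord_le z k) (mul_le_mul_of_nonneg_left (Real.exp_le_exp.2 ?_)
      (by positivity)) (by positivity) (norm_nonneg _)
    refine (le_abs_self _).trans ?_
    rw [abs_mul, abs_neg]
    refine mul_le_of_le_one_left (abs_nonneg _) (abs_le.2 ⟨?_, ?_⟩)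
    · linarith [hz.1]
    · linarith [hz.2]
  have hL : ∀ t : ℝ, ‖q (Complex.I * t)‖ ≤ ‖f‖ := fun t => by
    have h1 : ∀ k, ‖y k‖ / A * Real.exp ((2 * (Complex.I * t : ℂ).re - 1) * (-x k)) =
        (‖y k‖ / A) ^ 2 := fun k => by
      rcases (norm_nonneg (y k)).eq_or_lt with h | h
      · simp [← h]
      · simp only [Complex.mul_re, Complex.I_re, zero_mul, Complex.I_im, Complex.ofReal_im,
          mul_zero, sub_zero, zero_sub, neg_mul, one_mul, neg_neg, hx]
        rw [Real.exp_log (by positivity), pow_two]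
    calc ‖q (Complex.I * t)‖ ≤ ∑ k ∈ s, ‖f‖ * (‖y k‖ / A) ^ 2 := norm_sum_le_of_le _ fun k _ => by
          rw [norm_mul, hnq, h1]
          exact mul_le_mul_of_nonneg_right (f.norm_coord_le _ k) (by positivity)
      _ = ‖f‖ * (S / A ^ 2) := by
          simp only [div_pow]
          rw [← Finset.mul_sum, ← Finset.sum_div]
      _ = ‖f‖ := by rw [hAsq, div_self hSpos.ne', mul_one]
  have hR : ∀ t : ℝ, ‖q (1 + Complex.I * t)‖ ≤ ‖f‖ := fun t => by
    have h1 : ∀ k, ‖y k‖ / A * Real.exp ((2 * (1 + Complex.I * t : ℂ).re - 1) * (-x k)) ≤ 1 :=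
      fun k => by
      rcases (norm_nonneg (y k)).eq_or_lt with h | h
      · simp [← h]
      · have h2 : (2 * (1 + Complex.I * t : ℂ).re - 1) * (-x k) = -x k := by
          simp
          norm_num
        rw [h2, Real.exp_neg, Real.exp_log (by positivity)]
        exact mul_inv_le_one
    refine (norm_sum_le_of_le _ fun k _ => ?_).trans (f.sum_norm_right_le t s)
    rw [norm_mul, hnq]
    exact mul_le_of_le_one_right (norm_nonneg _) (h1 k)
  have hfin := norm_le_of_boundary hd hC hL hR half_mem_closedStrip
  have hqhalf : q (1 / 2) = A := by
    have h1 : ∀ k, f (1 / 2) k * (starRingEnd ℂ (y k) / A *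
        Complex.exp ((2 * (1 / 2 : ℂ) - 1) * (-x k : ℝ))) = ((‖y k‖ ^ 2 / A : ℝ) : ℂ) := fun k => by
      have h2 : (2 * (1 / 2 : ℂ) - 1) = 0 := by norm_num
      rw [h2, zero_mul, Complex.exp_zero, mul_one, mul_div_assoc', Complex.mul_conj,
        Complex.normSq_eq_norm_sq]
      push_cast
      rfl
    simp only [hq, h1]
    rw [← Complex.ofReal_sum, ← Finset.sum_div, ← hS, ← hAsq, pow_two, mul_div_assoc,
      div_self hApos.ne', mul_one]
  rw [hqhalf, Complex.norm_real, Real.norm_of_nonneg hApos.le] at hfin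
  rw [← hAsq]
  exact pow_le_pow_left₀ hApos.le hfin 2

end Calderon

/-! ### Random signs and logarithmic moments -/

/-- The sign of `l` in the choice of signs encoded by the finite set `s`. -/
def signOf (s : Finset ℕ) (l : ℕ) : ℂ := if l ∈ s then 1 else -1

theorem norm_signOf (s : Finset ℕ) (l : ℕ) : ‖signOf s l‖ = 1 := by
  unfold signOf
  split_ifs <;> simp

/-- Orthogonality of random signs. -/
theorem sum_powerset_norm_sq (T : Finset ℕ) (c : ℕ → ℂ) :
    ∑ s ∈ T.powerset, ‖∑ l ∈ T, signOf s l * c l‖ ^ 2 = 2 ^ T.card * ∑ l ∈ T, ‖c l‖ ^ 2 := by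
  induction T using Finset.induction_on with
  | empty => simp
  | insert a T ha ih =>
    have h1 : ∀ s ∈ T.powerset, ∑ l ∈ insert a T, signOf s l * c l =
        ∑ l ∈ T, signOf s l * c l - c a := fun s hs => by
      have : a ∉ s := fun h => ha (Finset.mem_powerset.1 hs h)
      rw [Finset.sum_insert ha, signOf, if_neg this]
      ring
    have h2 : ∀ s ∈ T.powerset, ∑ l ∈ insert a T, signOf (insert a s) l * c l =
        ∑ l ∈ T, signOf s l * c l + c a := fun s hs => by
      rw [Finset.sum_insert ha, signOf, if_pos (Finset.mem_insert_self a s), one_mul, add_comm]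
      congr 1
      refine Finset.sum_congr rfl fun l hl => ?_
      have : l ≠ a := fun h => ha (h ▸ hl)
      simp [signOf, this]
    rw [Finset.sum_powerset_insert ha, Finset.card_insert_of_notMem ha, Finset.sum_insert ha]
    rw [Finset.sum_congr rfl fun s hs => congrArg (fun x : ℂ => ‖x‖ ^ 2) (h1 s hs),
      Finset.sum_congr rfl fun s hs => congrArg (fun x : ℂ => ‖x‖ ^ 2) (h2 s hs),
      ← Finset.sum_add_distrib]
    have h3 : ∀ x : ℂ, ‖x - c a‖ ^ 2 + ‖x + c a‖ ^ 2 = 2 * ‖x‖ ^ 2 + 2 * ‖c a‖ ^ 2 := fun x => by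
      have := parallelogram_law_with_norm ℂ x (c a)
      linarith
    simp only [h3]
    rw [Finset.sum_add_distrib, ← Finset.mul_sum, ih, Finset.sum_const, Finset.card_powerset]
    simp only [nsmul_eq_mul]
    push_cast
    ring

/-- For `u ≥ 1`, `2 log u ≤ log N ≤ L`. For `u = exp (-x) ≤ 1`, the inequality `u x^i ≤ i!` absorbs
the logarithm; the summand 1 on the right accounts for this range. -/
theorem sq_mul_log_pow_le {u N L : ℝ} (hu : 0 < u) (hN : u ^ 2 ≤ N) (hL : 1 ≤ L)
    (hNL : Real.log N ≤ L) (i : ℕ) :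
    u ^ 2 * Real.log u ^ (2 * i) ≤ (i.factorial : ℝ) ^ 2 * ((1 + u ^ 2) * L ^ (2 * i)) := by
  have hf : (1 : ℝ) ≤ (i.factorial : ℝ) ^ 2 := by
    have : (1 : ℝ) ≤ i.factorial := by exact_mod_cast i.factorial_pos
    nlinarith
  have hLi : 1 ≤ L ^ (2 * i) := one_le_pow₀ hL
  rcases le_total 1 u with h | h
  · have h0 : 0 ≤ Real.log u := Real.log_nonneg h
    have h1 : Real.log u ≤ L := by
      have h2 := Real.log_le_log (by positivity) hN
      rw [Real.log_pow] at h2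
      push_cast at h2
      linarith
    calc u ^ 2 * Real.log u ^ (2 * i) ≤ u ^ 2 * L ^ (2 * i) := by gcongr
      _ ≤ (1 + u ^ 2) * L ^ (2 * i) := by gcongr; linarith
      _ ≤ _ := le_mul_of_one_le_left (by positivity) hf
  · set x := -Real.log u with hx
    have hx0 : 0 ≤ x := neg_nonneg.2 (Real.log_nonpos hu.le h)
    have hux : u = (Real.exp x)⁻¹ := by rw [hx, Real.exp_neg, Real.exp_log hu, inv_inv]
    have h1 : u * x ^ i ≤ i.factorial := by
      have h2 := Real.pow_div_factorial_le_exp x hx0 i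
      rw [div_le_iff₀ (by positivity)] at h2
      rw [hux, inv_mul_le_iff₀ (Real.exp_pos x)]
      exact h2
    have h2 : u ^ 2 * Real.log u ^ (2 * i) = (u * x ^ i) ^ 2 := by
      rw [mul_pow, ← pow_mul, mul_comm i 2, hx, Even.neg_pow (even_two_mul i)]
    rw [h2]
    calc (u * x ^ i) ^ 2 ≤ (i.factorial : ℝ) ^ 2 * 1 := by
          rw [mul_one]
          exact pow_le_pow_left₀ (by positivity) h1 2
      _ ≤ _ := by
          gcongr
          exact one_le_mul_of_one_le_of_one_le (by nlinarith) hLi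

/-- Since `W` is the quadratic mean of the `V l`, each `(V l / W)^2` is at most `N`, so the
pointwise bound applies, and `∑ (W^2 + V l^2) = 2 N W^2`. -/
theorem sum_sq_mul_log_pow_le {N : ℕ} {V : ℕ → ℝ} (hV : ∀ l, 0 < V l) {W L : ℝ} (hW : 0 < W)
    (hVW : ∑ l ∈ Finset.range N, V l ^ 2 = N * W ^ 2) (hL : 1 ≤ L) (hNL : Real.log N ≤ L) (i : ℕ) :
    ∑ l ∈ Finset.range N, V l ^ 2 * Real.log (V l / W) ^ (2 * i) ≤
      2 * (i.factorial : ℝ) ^ 2 * (N * L ^ (2 * i) * W ^ 2) := by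
  have h1 : ∀ l ∈ Finset.range N, V l ^ 2 * Real.log (V l / W) ^ (2 * i) ≤
      (i.factorial : ℝ) ^ 2 * L ^ (2 * i) * (W ^ 2 + V l ^ 2) := fun l hl => by
    have h2 : (V l / W) ^ 2 ≤ N := by
      rw [div_pow, div_le_iff₀ (by positivity), ← hVW]
      exact Finset.single_le_sum (f := fun l => V l ^ 2) (fun _ _ => sq_nonneg _) hl
    have h3 := sq_mul_log_pow_le (div_pos (hV l) hW) h2 hL hNL i
    have h4 := mul_le_mul_of_nonneg_left h3 (sq_nonneg W)
    have h5 : W ^ 2 * ((V l / W) ^ 2 * Real.log (V l / W) ^ (2 * i)) =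
        V l ^ 2 * Real.log (V l / W) ^ (2 * i) := by
      rw [← mul_assoc, ← mul_pow, mul_div_cancel₀ _ hW.ne']
    have h6 : W ^ 2 * (V l / W) ^ 2 = V l ^ 2 := by
      rw [← mul_pow, mul_div_cancel₀ _ hW.ne']
    rw [h5] at h4
    refine h4.trans (le_of_eq ?_)
    rw [← h6]
    ring
  refine (Finset.sum_le_sum h1).trans (le_of_eq ?_)
  rw [← Finset.mul_sum, Finset.sum_add_distrib, hVW, Finset.sum_const, Finset.card_range,
    nsmul_eq_mul]
  ring

/-- Changing the reference weight shifts all logarithms by the same `t`; the binomial expansion of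
the moments then reassembles to `(L + t)^j`. -/
theorem norm_sum_mul_sub_pow_le {N m : ℕ} {y : ℕ → ℂ} {r : ℕ → ℝ} {L U t : ℝ} (_ : 0 ≤ L)
    (_ : 0 ≤ U) (ht : 0 ≤ t)
    (h : ∀ i < m, ‖∑ l ∈ Finset.range N, y l * (r l : ℂ) ^ i‖ ≤ L ^ i * U) {j : ℕ} (hj : j < m) :
    ‖∑ l ∈ Finset.range N, y l * ((r l - t : ℝ) : ℂ) ^ j‖ ≤ (L + t) ^ j * U := by
  have h1 : ∑ l ∈ Finset.range N, y l * ((r l - t : ℝ) : ℂ) ^ j =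
      ∑ i ∈ Finset.range (j + 1), ((-t : ℝ) : ℂ) ^ (j - i) * (j.choose i : ℂ) *
        ∑ l ∈ Finset.range N, y l * (r l : ℂ) ^ i := by
    simp only [Finset.mul_sum]
    rw [Finset.sum_comm]
    refine Finset.sum_congr rfl fun l _ => ?_
    rw [sub_eq_add_neg, Complex.ofReal_add, add_pow, Finset.mul_sum]
    refine Finset.sum_congr rfl fun i _ => ?_
    ring
  rw [h1, add_pow, Finset.sum_mul]
  refine norm_sum_le_of_le _ fun i hi => ?_
  rw [norm_mul, norm_mul, norm_pow, Complex.norm_real, norm_neg, Real.norm_of_nonneg ht,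
    Complex.norm_natCast]
  have h2 := h i (by have := Finset.mem_range.1 hi; omega)
  calc t ^ (j - i) * (j.choose i : ℝ) * ‖∑ l ∈ Finset.range N, y l * (r l : ℂ) ^ i‖
      ≤ t ^ (j - i) * (j.choose i : ℝ) * (L ^ i * U) :=
        mul_le_mul_of_nonneg_left h2 (by positivity)
    _ = _ := by ring

/-! ### A bounded substitute for `z - 1/2` -/

/-- A bounded function on the strip that agrees with `z - 1/2` to order `m` at `1/2`. -/
noncomputable def theta (m : ℕ) (z : ℂ) : ℂ := 3 / 2 * ∑ i ∈ Finset.range m, phi z ^ (i + 1)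

/-- From `3/2 * phi z = (z - 1/2) (1 - phi z)`, the geometric sum collapses to `theta m z = (z -
1/2) (1 - phi z ^ m)`. -/
theorem theta_sub_eq (m : ℕ) {z : ℂ} (hz : z + 1 ≠ 0) :
    theta m z - (z - 1 / 2) = -(z - 1 / 2) * phi z ^ m := by
  have h1 : 3 / 2 * phi z = (z - 1 / 2) * (1 - phi z) := by
    rw [phi]
    field_simp
    ring
  have h2 : theta m z = (3 / 2 * phi z) * ∑ i ∈ Finset.range m, phi z ^ i := by
    rw [theta, mul_assoc, Finset.mul_sum]
    simp only [pow_succ']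
    rw [← Finset.mul_sum]
    simp only [Finset.mul_sum]
  rw [h2, h1, mul_assoc, mul_neg_geom_sum]
  ring

theorem eventually_mem_closedStrip : ∀ᶠ z in 𝓝 (1 / 2 : ℂ), z ∈ closedStrip :=
  mem_of_superset (Calderon.isOpen_strip.mem_nhds Calderon.half_mem) (closure_strip ▸ subset_closure)

theorem continuousAt_phi : ContinuousAt phi (1 / 2) :=
  (diffContOnCl_phi.differentiableOn.differentiableAt
    (Calderon.isOpen_strip.mem_nhds Calderon.half_mem)).continuousAt

theorem phi_half : phi (1 / 2) = 0 := by simp [phi]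

theorem phi_isBigO : phi =O[𝓝 (1 / 2)] fun z => z - 1 / 2 := by
  have h : ContinuousAt (fun z : ℂ => (z + 1)⁻¹) (1 / 2) :=
    ContinuousAt.inv₀ (by fun_prop) (add_one_ne_zero_of_mem half_mem_closedStrip)
  have h2 := (isBigO_refl (fun z : ℂ => z - 1 / 2) (𝓝 (1 / 2))).mul (h.isBigO_one ℂ)
  simp only [mul_one] at h2
  exact h2.congr_left fun z => (div_eq_mul_inv _ _).symm

theorem theta_sub_isBigO (m : ℕ) :
    (fun z => theta m z - (z - 1 / 2)) =O[𝓝 (1 / 2)] fun z => (z - 1 / 2) ^ m := by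
  have h1 : (fun z : ℂ => -(z - 1 / 2)) =O[𝓝 (1 / 2)] fun _ => (1 : ℂ) :=
    Tendsto.isBigO_one ℂ (ContinuousAt.tendsto (by fun_prop))
  have h2 := h1.mul (phi_isBigO.pow m)
  simp only [one_mul] at h2
  refine h2.congr' ?_ EventuallyEq.rfl
  filter_upwards [eventually_mem_closedStrip] with z hz
  rw [theta_sub_eq m (add_one_ne_zero_of_mem hz)]

theorem continuousAt_theta (m : ℕ) : ContinuousAt (theta m) (1 / 2) := by
  have := continuousAt_phi
  unfold theta
  fun_prop

theorem theta_half (m : ℕ) : theta m (1 / 2) = 0 := by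
  simp only [theta, phi_half]
  simp

theorem theta_isBigO (m : ℕ) : theta m =O[𝓝 (1 / 2)] fun z => z - 1 / 2 := by
  unfold theta
  refine IsBigO.const_mul_left (IsBigO.fun_sum fun i _ => ?_) _
  have h1 : (fun z => phi z ^ i) =O[𝓝 (1 / 2)] fun _ => (1 : ℂ) :=
    (continuousAt_phi.pow i).isBigO_one ℂ
  simpa [pow_succ] using h1.mul phi_isBigO

/-- Replacing `z - 1/2` by `theta m z` in the exponent changes the exponential by a factor `1 + O((z
- 1/2)^m)`. The rest is the Taylor expansion in `theta m z = O(z - 1/2)`. -/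
theorem exp_sub_sum_theta_isBigO (m : ℕ) (a : ℂ) :
    (fun z => Complex.exp ((2 * z - 1) * a) -
      ∑ j ∈ Finset.range m, theta m z ^ j * ((2 * a) ^ j / j.factorial)) =O[𝓝 (1 / 2)]
        fun z => (z - 1 / 2) ^ m := by
  have hct : ContinuousAt (fun z => 2 * a * theta m z) (1 / 2) := (continuousAt_theta m).const_mul _
  have h1 : (fun z => Complex.exp (2 * a * theta m z) -
      ∑ j ∈ Finset.range m, (2 * a * theta m z) ^ j / j.factorial) =O[𝓝 (1 / 2)]
        fun z => (z - 1 / 2) ^ m := by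
    have h2 : Tendsto (fun z => 2 * a * theta m z) (𝓝 (1 / 2)) (𝓝 0) := by
      have := hct.tendsto
      rwa [theta_half, mul_zero] at this
    refine ((Complex.exp_sub_sum_range_isBigO_pow m).comp_tendsto h2).trans ?_
    exact ((theta_isBigO m).const_mul_left (2 * a)).pow m
  have h3 : (fun z => Complex.exp (2 * a * theta m z) *
      (Complex.exp (-(2 * a) * (theta m z - (z - 1 / 2))) - 1)) =O[𝓝 (1 / 2)]
        fun z => (z - 1 / 2) ^ m := by
    have h4 : (fun z => Complex.exp (2 * a * theta m z)) =O[𝓝 (1 / 2)] fun _ => (1 : ℂ) :=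
      hct.cexp.isBigO_one ℂ
    have h5 : Tendsto (fun z => -(2 * a) * (theta m z - (z - 1 / 2))) (𝓝 (1 / 2)) (𝓝 0) := by
      have h6 : ContinuousAt (fun z => -(2 * a) * (theta m z - (z - 1 / 2))) (1 / 2) :=
        ((continuousAt_theta m).sub (by fun_prop)).const_mul _
      have := h6.tendsto
      rwa [theta_half, sub_self, sub_self, mul_zero] at this
    have h7 := (Complex.exp_sub_sum_range_isBigO_pow 1).comp_tendsto h5
    simp only [Finset.sum_range_one, pow_zero, Nat.factorial_zero, Nat.cast_one, div_one,
      pow_one] at h7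
    simpa using h4.mul (h7.trans ((theta_sub_isBigO m).const_mul_left _))
  refine (h1.add h3).congr_left fun z => ?_
  rw [mul_sub, ← Complex.exp_add, mul_one]
  have h8 : 2 * a * theta m z + -(2 * a) * (theta m z - (z - 1 / 2)) = (2 * z - 1) * a := by ring
  have h9 : ∀ j ∈ Finset.range m, (2 * a * theta m z) ^ j / (j.factorial : ℂ) =
      theta m z ^ j * ((2 * a) ^ j / j.factorial) := fun j _ => by
    rw [mul_pow]
    ring
  rw [h8, Finset.sum_congr rfl h9]
  ring

namespace Calderon

theorem mulPhi_pow_coord (i : ℕ) (f : Calderon) (z : ℂ) (k : ℕ) :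
    (mulPhi ^ i) f z k = phi z ^ i * f z k := by
  induction i with
  | zero => simp
  | succ i ih =>
    rw [pow_succ', Module.End.mul_apply, mulPhi_coord, ih]
    ring

theorem norm_mulPhi_pow_le (i : ℕ) (f : Calderon) : ‖(mulPhi ^ i) f‖ ≤ ‖f‖ := by
  induction i with
  | zero => simp
  | succ i ih =>
    rw [pow_succ', Module.End.mul_apply]
    exact (norm_mulPhi_le _).trans ih

theorem smul_coord (c : ℂ) (f : Calderon) (z : ℂ) (k : ℕ) : (c • f) z k = c * f z k := rfl

theorem sum_coord {ι : Type*} (s : Finset ι) (f : ι → Calderon) (z : ℂ) (k : ℕ) :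
    (∑ i ∈ s, f i) z k = ∑ i ∈ s, f i z k := by
  classical
  induction s using Finset.induction_on with
  | empty => rfl
  | insert a s ha ih =>
    rw [Finset.sum_insert ha, Finset.sum_insert ha, ← ih]
    rfl

/-- Multiplication by `theta m` on the Calderón space. -/
noncomputable def mulTheta (m : ℕ) : Module.End ℂ Calderon :=
  (3 / 2 : ℂ) • ∑ i ∈ Finset.range m, mulPhi ^ (i + 1)

theorem mulTheta_coord (m : ℕ) (f : Calderon) (z : ℂ) (k : ℕ) :
    mulTheta m f z k = theta m z * f z k := by
  rw [mulTheta, LinearMap.smul_apply, LinearMap.sum_apply, smul_coord, sum_coord, theta]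
  simp only [mulPhi_pow_coord]
  rw [← Finset.sum_mul, mul_assoc]

theorem norm_mulTheta_le (m : ℕ) (f : Calderon) : ‖mulTheta m f‖ ≤ 2 * m * ‖f‖ := by
  rw [mulTheta, LinearMap.smul_apply, LinearMap.sum_apply, norm_smul]
  have h1 : ‖∑ i ∈ Finset.range m, (mulPhi ^ (i + 1)) f‖ ≤ m * ‖f‖ := by
    refine (norm_sum_le_of_le _ fun i _ => norm_mulPhi_pow_le (i + 1) f).trans (le_of_eq ?_)
    simp
  have h2 : ‖(3 / 2 : ℂ)‖ ≤ 2 := by norm_num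
  calc ‖(3 / 2 : ℂ)‖ * ‖∑ i ∈ Finset.range m, (mulPhi ^ (i + 1)) f‖ ≤ 2 * (m * ‖f‖) :=
        mul_le_mul h2 h1 (norm_nonneg _) (by norm_num)
    _ = _ := by ring

theorem mulTheta_pow_coord (m j : ℕ) (f : Calderon) (z : ℂ) (k : ℕ) :
    (mulTheta m ^ j) f z k = theta m z ^ j * f z k := by
  induction j with
  | zero => simp
  | succ j ih =>
    rw [pow_succ', Module.End.mul_apply, mulTheta_coord, ih]
    ring

theorem norm_mulTheta_pow_le (m j : ℕ) (f : Calderon) :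
    ‖(mulTheta m ^ j) f‖ ≤ (2 * m) ^ j * ‖f‖ := by
  induction j with
  | zero => simp
  | succ j ih =>
    rw [pow_succ', Module.End.mul_apply]
    refine (norm_mulTheta_le m _).trans ?_
    rw [pow_succ', mul_assoc (2 * (m : ℝ))]
    exact mul_le_mul_of_nonneg_left ih (by positivity)


/-! ### Upper bound for random signed sums -/

/-- A sum of weighted functions has the same Taylor coefficients as a function built on a single
weight. -/
theorem norm_toZ_le_of_log_moments {N m : ℕ} {V : ℕ → ℕ → ℝ} (hV : ∀ l k, 0 < V l k)
    {y : ℕ → ℕ → ℂ} {W U : ℕ → ℝ} (hW : ∀ k, 0 < W k) (hWU : ∀ k, W k ≤ U k) {D L S : ℝ}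
    (hL : 1 ≤ L) (hD : 0 ≤ D) (hS : 0 ≤ S) (hUW : ∀ k, Real.log (U k / W k) ≤ D * L)
    (hmom : ∀ k, ∀ i < m, ‖∑ l ∈ Finset.range N, y l k * ((Real.log (V l k / W k) : ℝ) : ℂ) ^ i‖ ≤
      L ^ i * (S * U k))
    (hU : Summable fun k => U k ^ 2) {f : Calderon}
    (hf : ∀ z ∈ closedStrip, ∀ k, f z k = ∑ l ∈ Finset.range N,
      y l k * Complex.exp ((2 * z - 1) * (Real.log (V l k) : ℝ))) :
    ‖toZ m f‖ ≤ m * (2 * m) ^ m * (Real.exp 1 * (2 * (1 + D)) ^ m) * (S * L ^ (m - 1)) *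
      (1 + 2 * ∑' k, U k ^ 2) := by
  have hUpos : ∀ k, 0 < U k := fun k => (hW k).trans_le (hWU k)
  -- The common weight is `lam * U` rather than `U`, because `exists_weighted` requires the
  -- quotients of coefficients by weights to tend to zero.
  obtain ⟨lam, hlam1, hlam, hlamsum⟩ :=
    hU.exists_tendsto_atTop_mul_le fun k => pow_pos (hUpos k) 2
  have hlampos : ∀ k, 0 < lam k := fun k => one_pos.trans_le (hlam1 k)
  set X : ℕ → ℝ := fun k => lam k * U k with hX
  have hXpos : ∀ k, 0 < X k := fun k => mul_pos (hlampos k) (hUpos k)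
  set x : ℕ → ℝ := fun k => 1 + Real.log (lam k) with hx
  have hx1 : ∀ k, 1 ≤ x k := fun k => by
    simp only [hx]
    linarith [Real.log_nonneg (hlam1 k)]
  have hxlim : Tendsto x atTop atTop :=
    tendsto_atTop_add_const_left _ _ (Real.tendsto_log_atTop.comp hlam)
  have hexpx : ∀ k, Real.exp 1 * Real.exp (-x k) = (lam k)⁻¹ := fun k => by
    rw [← Real.exp_add]
    simp only [hx]
    rw [show 1 + -(1 + Real.log (lam k)) = -Real.log (lam k) by ring, Real.exp_neg,
      Real.exp_log (hlampos k)]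
  set t : ℕ → ℝ := fun k => Real.log (X k / W k) with ht
  have ht0 : ∀ k, 0 ≤ t k := fun k => by
    refine Real.log_nonneg ((one_le_div (hW k)).2 ((hWU k).trans ?_))
    exact le_mul_of_one_le_left (hUpos k).le (hlam1 k)
  have htx : ∀ k, L + t k ≤ L * (1 + D) * x k := fun k => by
    have h1 : t k = Real.log (lam k) + Real.log (U k / W k) := by
      simp only [ht, hX]
      rw [mul_div_assoc, Real.log_mul (hlampos k).ne' (div_pos (hUpos k) (hW k)).ne']
    have h2 := hUW k
    have h3 := Real.log_nonneg (hlam1 k)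
    rw [h1]
    simp only [hx]
    nlinarith [mul_nonneg (sub_nonneg.2 hL) h3, mul_nonneg (mul_nonneg hD h3)
      (zero_le_one.trans hL)]
  set H : ℕ → ℕ → ℂ := fun j k => ∑ l ∈ Finset.range N,
    y l k * ((Real.log (V l k / X k) : ℝ) : ℂ) ^ j with hH
  have hlog : ∀ l k, Real.log (V l k / X k) = Real.log (V l k / W k) - t k := fun l k => by
    simp only [ht]
    rw [Real.log_div (hV l k).ne' (hXpos k).ne', Real.log_div (hV l k).ne' (hW k).ne',
      Real.log_div (hXpos k).ne' (hW k).ne']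
    ring
  have hHle : ∀ j < m, ∀ k, ‖H j k‖ ≤ (L + t k) ^ j * (S * U k) := fun j hj k => by
    simp only [hH, hlog]
    exact norm_sum_mul_sub_pow_le (zero_le_one.trans hL) (mul_nonneg hS (hUpos k).le) (ht0 k)
      (hmom k) hj
  set Y : ℕ → ℕ → ℂ := fun j k => (2 ^ j / j.factorial : ℂ) * H j k with hY
  -- The moments about `X` contain the unbounded `log (lam k)`, which costs `x k ^ j`. The gain `U k
  -- / X k = (lam k)⁻¹ = e * exp (-x k)` outweighs it and also forces the quotient to zero.
  have hYle : ∀ j < m, ∀ k, ‖Y j k‖ / X k ≤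
      2 ^ j / j.factorial * (L * (1 + D)) ^ j * S * Real.exp 1 * (x k ^ j * Real.exp (-x k)) :=
    fun j hj k => by
    rw [div_le_iff₀ (hXpos k)]
    simp only [hY]
    rw [norm_mul]
    have h1 : ‖(2 ^ j / j.factorial : ℂ)‖ = 2 ^ j / j.factorial := by simp
    have h2 : ‖H j k‖ ≤ (L * (1 + D) * x k) ^ j * (S * U k) := by
      refine (hHle j hj k).trans ?_
      refine mul_le_mul_of_nonneg_right ?_ (mul_nonneg hS (hUpos k).le)
      exact pow_le_pow_left₀ (add_nonneg (zero_le_one.trans hL) (ht0 k)) (htx k) j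
    rw [h1]
    refine (mul_le_mul_of_nonneg_left h2 (by positivity)).trans (le_of_eq ?_)
    have h3 : U k = (lam k)⁻¹ * X k := by
      simp only [hX]
      rw [inv_mul_cancel_left₀ (hlampos k).ne']
    rw [h3, ← hexpx, mul_pow _ (x k)]
    ring
  set M : ℝ := Real.exp 1 * (2 * (1 + D)) ^ m * (S * L ^ (m - 1)) with hM
  have hM0 : 0 ≤ M := by positivity
  have hYM : ∀ j < m, ∀ k, ‖Y j k‖ ≤ M * X k := fun j hj k => by
    rw [← div_le_iff₀ (hXpos k)]
    refine (hYle j hj k).trans ?_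
    have h1 : x k ^ j * Real.exp (-x k) ≤ j.factorial := by
      have h2 := Real.pow_div_factorial_le_exp (x k) (zero_le_one.trans (hx1 k)) j
      rw [div_le_iff₀ (by positivity)] at h2
      rw [Real.exp_neg, ← div_eq_mul_inv, div_le_iff₀ (Real.exp_pos _), mul_comm]
      exact h2
    calc 2 ^ j / j.factorial * (L * (1 + D)) ^ j * S * Real.exp 1 * (x k ^ j * Real.exp (-x k))
        ≤ 2 ^ j / j.factorial * (L * (1 + D)) ^ j * S * Real.exp 1 * j.factorial :=
          mul_le_mul_of_nonneg_left h1 (by positivity)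
      _ = Real.exp 1 * (2 * (1 + D)) ^ j * (S * L ^ j) := by
          have : (j.factorial : ℝ) ≠ 0 := by positivity
          rw [mul_pow, mul_pow]
          field_simp
      _ ≤ M := by
          simp only [hM]
          have h3 : (1 : ℝ) ≤ 2 * (1 + D) := by linarith
          have h4 : L ^ j ≤ L ^ (m - 1) := pow_le_pow_right₀ hL (by omega)
          have h5 : (2 * (1 + D)) ^ j ≤ (2 * (1 + D)) ^ m := pow_le_pow_right₀ h3 hj.le
          gcongr
  have hYlim : ∀ j < m, Tendsto (fun k => ‖Y j k‖ / X k) atTop (𝓝 0) := fun j hj => by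
    refine squeeze_zero (fun k => div_nonneg (norm_nonneg _) (hXpos k).le) (hYle j hj) ?_
    have h1 := ((Real.tendsto_pow_mul_exp_neg_atTop_nhds_zero j).comp hxlim).const_mul
      (2 ^ j / j.factorial * (L * (1 + D)) ^ j * S * Real.exp 1)
    rwa [mul_zero] at h1
  have hXB : ∀ s : Finset ℕ, ∑ k ∈ s, X k ^ 2 ≤ 2 * ∑' k, U k ^ 2 := fun s => by
    simp only [hX, mul_pow]
    exact hlamsum s
  have hB0 : 0 ≤ 2 * ∑' k, U k ^ 2 := by simpa using hXB ∅
  have hg : ∀ j, ∃ g : Calderon, j < m → (∀ z ∈ closedStrip, ∀ k,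
      g z k = Y j k * Complex.exp ((2 * z - 1) * (Real.log (X k) : ℝ))) ∧
        ‖g‖ ≤ M * (1 + 2 * ∑' k, U k ^ 2) := fun j => by
    by_cases hj : j < m
    · obtain ⟨g, hg1, hg2⟩ := exists_weighted hXpos hM0 (hYM j hj) (hYlim j hj) hXB
      refine ⟨g, fun _ => ⟨hg1, hg2.trans (mul_le_mul_of_nonneg_left ?_ hM0)⟩⟩
      exact max_le (by linarith) (by linarith)
    · exact ⟨0, fun h => absurd h hj⟩
  choose g hg using hg
  -- In each coordinate `V_l^(2z-1) = X^(2z-1) exp ((2z-1) log (V_l / X))`, and the second factor is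
  -- expanded in powers of `theta m`.
  have hval : toZ m f = toZ m (∑ j ∈ Finset.range m, (mulTheta m ^ j) (g j)) := by
    refine toZ_eq_of_isBigO fun k => ?_
    have h1 : (fun z => ∑ l ∈ Finset.range N,
        (y l k * Complex.exp ((2 * z - 1) * (Real.log (X k) : ℝ))) *
        (Complex.exp ((2 * z - 1) * (Real.log (V l k / X k) : ℝ)) - ∑ j ∈ Finset.range m,
          theta m z ^ j * ((2 * ((Real.log (V l k / X k) : ℝ) : ℂ)) ^ j / j.factorial)))
        =O[𝓝 (1 / 2)] fun z => (z - 1 / 2) ^ m := by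
      refine IsBigO.fun_sum fun l _ => ?_
      have h2 : (fun z : ℂ => y l k * Complex.exp ((2 * z - 1) * (Real.log (X k) : ℝ)))
          =O[𝓝 (1 / 2)] fun _ => (1 : ℂ) :=
        Tendsto.isBigO_one ℂ (ContinuousAt.tendsto (by fun_prop))
      simpa only [one_mul] using h2.mul (exp_sub_sum_theta_isBigO m _)
    refine h1.congr' ?_ EventuallyEq.rfl
    filter_upwards [eventually_mem_closedStrip] with z hz
    have h3 : ∀ l, Complex.exp ((2 * z - 1) * (Real.log (X k) : ℝ)) *
        Complex.exp ((2 * z - 1) * (Real.log (V l k / X k) : ℝ)) =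
        Complex.exp ((2 * z - 1) * (Real.log (V l k) : ℝ)) := fun l => by
      rw [← Complex.exp_add, ← mul_add, ← Complex.ofReal_add,
        Real.log_div (hV l k).ne' (hXpos k).ne', add_sub_cancel]
    have h4 : (∑ j ∈ Finset.range m, (mulTheta m ^ j) (g j)) z k = ∑ l ∈ Finset.range N,
        (y l k * Complex.exp ((2 * z - 1) * (Real.log (X k) : ℝ))) * ∑ j ∈ Finset.range m,
          theta m z ^ j * ((2 * ((Real.log (V l k / X k) : ℝ) : ℂ)) ^ j / j.factorial) := by
      simp only [Finset.mul_sum]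
      rw [sum_coord, Finset.sum_comm]
      refine Finset.sum_congr rfl fun j hj => ?_
      rw [mulTheta_pow_coord, (hg j (Finset.mem_range.1 hj)).1 z hz k]
      simp only [hY, hH]
      rw [Finset.mul_sum, Finset.sum_mul, Finset.mul_sum]
      refine Finset.sum_congr rfl fun l _ => ?_
      rw [mul_pow]
      ring
    rw [h4, hf z hz k, ← Finset.sum_sub_distrib]
    refine Finset.sum_congr rfl fun l _ => ?_
    rw [mul_sub, mul_assoc, h3]
  rw [hval]
  refine (norm_toZ_le _ _).trans ?_
  have hR : 0 ≤ M * (1 + 2 * ∑' k, U k ^ 2) := mul_nonneg hM0 (by linarith)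
  calc ‖∑ j ∈ Finset.range m, (mulTheta m ^ j) (g j)‖
      ≤ ∑ j ∈ Finset.range m, (2 * m : ℝ) ^ m * (M * (1 + 2 * ∑' k, U k ^ 2)) := by
        refine norm_sum_le_of_le _ fun j hj => ?_
        have hj := Finset.mem_range.1 hj
        refine (norm_mulTheta_pow_le m j _).trans ?_
        have hm1 : (1 : ℝ) ≤ 2 * m := by
          have : (1 : ℝ) ≤ m := by exact_mod_cast Nat.one_le_of_lt hj
          linarith
        exact mul_le_mul (pow_le_pow_right₀ hm1 hj.le) (hg j hj).2 (norm_nonneg _) (by positivity)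
    _ = _ := by
        rw [Finset.sum_const, Finset.card_range, nsmul_eq_mul]
        simp only [hM]
        ring

/-- The common weight depends on the signs: it is enlarged wherever a signed logarithmic moment is
large. Orthogonality of the signs keeps its squared `ℓ_2` norm bounded on average, and that norm
enters the bound of `norm_toZ_le_of_log_moments` linearly. -/
theorem exists_sum_norm_toZ_weighted_le (m : ℕ) : ∃ C : ℝ, 0 ≤ C ∧ ∀ (N : ℕ), 0 < N →
    ∀ (V : ℕ → ℕ → ℝ) (y : ℕ → ℕ → ℂ) (f : ℕ → Calderon), (∀ l k, 0 < V l k) →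
      (∀ l k, ‖y l k‖ ≤ V l k) → (∀ l, ∀ s : Finset ℕ, ∑ k ∈ s, V l k ^ 2 ≤ 1) →
      (∀ l, ∀ z ∈ closedStrip, ∀ k,
        f l z k = y l k * Complex.exp ((2 * z - 1) * (Real.log (V l k) : ℝ))) →
      ∑ s ∈ (Finset.range N).powerset, ‖toZ m (∑ l ∈ Finset.range N, signOf s l • f l)‖ ≤
        2 ^ N * (C * (√N * (1 + Real.log N) ^ (m - 1))) := by
  set D : ℝ := 1 + 2 * ∑ i ∈ Finset.range m, (i.factorial : ℝ) ^ 2 with hD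
  have hD1 : 1 ≤ D := by
    have : 0 ≤ 2 * ∑ i ∈ Finset.range m, (i.factorial : ℝ) ^ 2 := by positivity
    linarith
  have hD0 : 0 < D := one_pos.trans_le hD1
  set C₁ : ℝ := m * (2 * m) ^ m * (Real.exp 1 * (2 * (1 + D)) ^ m) with hC₁
  have hC₁0 : 0 ≤ C₁ := by positivity
  refine ⟨C₁ * (1 + 2 * D), by positivity, fun N hN V y f hV hy hVs hf => ?_⟩
  have hN0 : (0 : ℝ) < N := by exact_mod_cast hN
  have hN1 : (1 : ℝ) ≤ N := by exact_mod_cast hN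
  set L : ℝ := 1 + Real.log N with hLdef
  have hlogN : 0 ≤ Real.log N := Real.log_nonneg hN1
  have hL : 1 ≤ L := by linarith
  have hL0 : 0 < L := one_pos.trans_le hL
  have hNL : Real.log N ≤ L := by linarith
  set w : ℕ → ℝ := fun k => (∑ l ∈ Finset.range N, V l k ^ 2) / N with hw
  have hwpos : ∀ k, 0 < w k := fun k => div_pos
    (Finset.sum_pos (fun l _ => pow_pos (hV l k) 2) (Finset.nonempty_range_iff.2 hN.ne')) hN0
  set W : ℕ → ℝ := fun k => √(w k) with hWdef
  have hW : ∀ k, 0 < W k := fun k => Real.sqrt_pos.2 (hwpos k)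
  have hWsq : ∀ k, W k ^ 2 = w k := fun k => Real.sq_sqrt (hwpos k).le
  have hVW : ∀ k, ∑ l ∈ Finset.range N, V l k ^ 2 = N * W k ^ 2 := fun k => by
    rw [hWsq]
    simp only [hw]
    rw [mul_div_cancel₀ _ hN0.ne']
  have hWs : ∀ s : Finset ℕ, ∑ k ∈ s, W k ^ 2 ≤ 1 := fun s => by
    simp only [hWsq, hw]
    rw [← Finset.sum_div, Finset.sum_comm, div_le_one hN0]
    refine (Finset.sum_le_sum fun l _ => hVs l s).trans ?_
    simp
  have hWsum : Summable fun k => W k ^ 2 := summable_of_sum_le (fun k => sq_nonneg _) hWs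
  have hWtsum : ∑' k, W k ^ 2 ≤ 1 := hWsum.tsum_le_of_sum_le hWs
  set r : ℕ → ℕ → ℝ := fun l k => Real.log (V l k / W k) with hr
  set h : Finset ℕ → ℕ → ℕ → ℂ := fun s i k =>
    ∑ l ∈ Finset.range N, signOf s l * (y l k * (r l k : ℂ) ^ i) with hh
  have hQ : ∀ i k, ∑ l ∈ Finset.range N, ‖y l k * (r l k : ℂ) ^ i‖ ^ 2 ≤
      2 * (i.factorial : ℝ) ^ 2 * (N * L ^ (2 * i) * W k ^ 2) := fun i k => by
    refine le_trans (Finset.sum_le_sum fun l _ => ?_)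
      (sum_sq_mul_log_pow_le (fun l => hV l k) (hW k) (hVW k) hL hNL i)
    rw [norm_mul, norm_pow, Complex.norm_real, mul_pow, ← pow_mul, mul_comm i 2,
      Real.norm_eq_abs, Even.pow_abs (even_two_mul i)]
    exact mul_le_mul_of_nonneg_right (pow_le_pow_left₀ (norm_nonneg _) (hy l k) 2)
      ((even_two_mul i).pow_nonneg _)
  -- Chosen so that the moment bounds with weight `√(u s k)` hold by construction for every choice
  -- of signs.
  set u : Finset ℕ → ℕ → ℝ := fun s k =>
    W k ^ 2 + ∑ i ∈ Finset.range m, ‖h s i k‖ ^ 2 / (N * L ^ (2 * i)) with hu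
  have hwu : ∀ s k, W k ^ 2 ≤ u s k := fun s k => by
    simp only [hu]
    exact le_add_of_nonneg_right (Finset.sum_nonneg fun i _ => by positivity)
  have hupos : ∀ s k, 0 < u s k := fun s k => (pow_pos (hW k) 2).trans_le (hwu s k)
  have hhu : ∀ s k, ∀ i < m, ‖h s i k‖ ≤ L ^ i * (√N * √(u s k)) := fun s k i hi => by
    have h1 : ‖h s i k‖ ^ 2 / (N * L ^ (2 * i)) ≤ u s k := by
      simp only [hu]
      refine le_add_of_nonneg_of_le (sq_nonneg _) ?_
      exact Finset.single_le_sum (f := fun i => ‖h s i k‖ ^ 2 / (N * L ^ (2 * i)))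
        (fun i _ => by positivity) (Finset.mem_range.2 hi)
    rw [div_le_iff₀ (by positivity)] at h1
    refine le_of_sq_le_sq ?_ (by positivity)
    rw [mul_pow, mul_pow, Real.sq_sqrt hN0.le, Real.sq_sqrt (hupos s k).le, ← pow_mul,
      mul_comm i 2]
    refine h1.trans (le_of_eq (by ring))
  -- Cauchy–Schwarz loses a factor `N` here, but this bound only serves for `log (√u / W)` and for
  -- summability. The sharp bound is the average `hsumu`.
  have huW : ∀ s k, u s k ≤ D * N * W k ^ 2 := fun s k => by
    have h1 : ∀ i ∈ Finset.range m, ‖h s i k‖ ^ 2 / (N * L ^ (2 * i)) ≤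
        2 * (i.factorial : ℝ) ^ 2 * (N * W k ^ 2) := fun i _ => by
      rw [div_le_iff₀ (by positivity)]
      have h2 : ‖h s i k‖ ≤ ∑ l ∈ Finset.range N, ‖y l k * (r l k : ℂ) ^ i‖ := by
        refine norm_sum_le_of_le _ fun l _ => ?_
        rw [norm_mul, norm_signOf, one_mul]
      have h3 := sq_sum_le_card_mul_sum_sq (s := Finset.range N)
        (f := fun l => ‖y l k * (r l k : ℂ) ^ i‖)
      rw [Finset.card_range] at h3
      refine (pow_le_pow_left₀ (norm_nonneg _) h2 2).trans (h3.trans ?_)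
      refine (mul_le_mul_of_nonneg_left (hQ i k) hN0.le).trans (le_of_eq (by ring))
    have h4 : W k ^ 2 ≤ N * W k ^ 2 := le_mul_of_one_le_left (sq_nonneg _) hN1
    simp only [hu]
    refine (add_le_add h4 (Finset.sum_le_sum h1)).trans (le_of_eq ?_)
    rw [← Finset.sum_mul, ← Finset.mul_sum, hD]
    ring
  have hlogUW : ∀ s k, Real.log (√(u s k) / W k) ≤ D * L := fun s k => by
    have h1 : u s k / W k ^ 2 ≤ D * N := (div_le_iff₀ (pow_pos (hW k) 2)).2 (huW s k)
    have h2 := Real.log_le_log (div_pos (hupos s k) (pow_pos (hW k) 2)) h1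
    rw [Real.log_mul hD0.ne' hN0.ne'] at h2
    have h3 : u s k / W k ^ 2 = (√(u s k) / W k) ^ 2 := by
      rw [div_pow, Real.sq_sqrt (hupos s k).le]
    rw [h3, Real.log_pow] at h2
    push_cast at h2
    have h4 : Real.log D ≤ D := (Real.log_le_sub_one_of_pos hD0).trans (by linarith)
    nlinarith
  have hsumu : ∀ k, ∑ s ∈ (Finset.range N).powerset, u s k ≤ 2 ^ N * D * W k ^ 2 := fun k => by
    have h1 : ∀ i ∈ Finset.range m, ∑ s ∈ (Finset.range N).powerset,
        ‖h s i k‖ ^ 2 / (N * L ^ (2 * i)) ≤ 2 ^ N * (2 * (i.factorial : ℝ) ^ 2 * W k ^ 2) :=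
      fun i _ => by
      rw [← Finset.sum_div, div_le_iff₀ (by positivity)]
      simp only [hh]
      rw [sum_powerset_norm_sq, Finset.card_range]
      refine (mul_le_mul_of_nonneg_left (hQ i k) (by positivity)).trans (le_of_eq (by ring))
    simp only [hu]
    rw [Finset.sum_add_distrib, Finset.sum_const, Finset.card_powerset, Finset.card_range,
      Finset.sum_comm, nsmul_eq_mul]
    refine (add_le_add_right (Finset.sum_le_sum h1) _).trans (le_of_eq ?_)
    rw [← Finset.mul_sum, ← Finset.sum_mul, ← Finset.mul_sum, hD]
    push_cast
    ring
  have husum : ∀ s, Summable fun k => u s k := fun s =>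
    Summable.of_nonneg_of_le (fun k => (hupos s k).le) (huW s) (hWsum.mul_left _)
  have hBsum : ∑ s ∈ (Finset.range N).powerset, ∑' k, u s k ≤ 2 ^ N * D := by
    rw [← Summable.tsum_finsetSum fun s _ => husum s]
    refine (Summable.tsum_le_tsum hsumu (summable_sum fun s _ => husum s)
      (hWsum.mul_left _)).trans ?_
    rw [tsum_mul_left]
    exact mul_le_of_le_one_right (mul_nonneg (pow_nonneg two_pos.le N) hD0.le) hWtsum
  have hmain : ∀ s, ‖toZ m (∑ l ∈ Finset.range N, signOf s l • f l)‖ ≤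
      C₁ * (√N * L ^ (m - 1)) * (1 + 2 * ∑' k, u s k) := fun s => by
    have hsq : ∀ k, √(u s k) ^ 2 = u s k := fun k => Real.sq_sqrt (hupos s k).le
    have h1 := norm_toZ_le_of_log_moments (N := N) (m := m) (V := V)
      (y := fun l k => signOf s l * y l k) (W := W) (U := fun k => √(u s k)) (D := D) (L := L)
      (S := √N) (f := ∑ l ∈ Finset.range N, signOf s l • f l) hV hW
      (fun k => Real.le_sqrt_of_sq_le (hwu s k)) hL hD0.le (Real.sqrt_nonneg _) (hlogUW s)
      (fun k i hi => by
        have h2 := hhu s k i hi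
        simp only [hh, hr] at h2
        simpa only [mul_assoc] using h2)
      (by simpa only [hsq] using husum s)
      (fun z hz k => by
        rw [sum_coord]
        refine Finset.sum_congr rfl fun l _ => ?_
        rw [smul_coord, hf l z hz k, mul_assoc])
    simpa only [hsq] using h1
  calc ∑ s ∈ (Finset.range N).powerset, ‖toZ m (∑ l ∈ Finset.range N, signOf s l • f l)‖
      ≤ ∑ s ∈ (Finset.range N).powerset, C₁ * (√N * L ^ (m - 1)) * (1 + 2 * ∑' k, u s k) :=
        Finset.sum_le_sum fun s _ => hmain s
    _ = C₁ * (√N * L ^ (m - 1)) *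
          (2 ^ N + 2 * ∑ s ∈ (Finset.range N).powerset, ∑' k, u s k) := by
        rw [← Finset.mul_sum, Finset.sum_add_distrib, ← Finset.mul_sum, Finset.sum_const,
          Finset.card_powerset, Finset.card_range]
        simp
    _ ≤ C₁ * (√N * L ^ (m - 1)) * (2 ^ N + 2 * (2 ^ N * D)) :=
        mul_le_mul_of_nonneg_left (by linarith) (mul_nonneg hC₁0
          (mul_nonneg (Real.sqrt_nonneg _) (pow_nonneg hL0.le _)))
    _ = _ := by ring


/-- As `phi` vanishes at `1/2`, the first `m + 1` coefficients of `phi f` depend only on the first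
`m` of `f`, so any representative of the shorter jet may be multiplied by `phi`. -/
theorem norm_toZ_succ_mulPhi_le (m : ℕ) (f : Calderon) :
    ‖toZ (m + 1) (mulPhi f)‖ ≤ ‖toZ m f‖ := by
  refine le_of_forall_gt fun r hr => ?_
  obtain ⟨g, hg, hgr⟩ := exists_toZ_eq (toZ m f) hr
  have h : toZ (m + 1) (mulPhi f) = toZ (m + 1) (mulPhi g) := by
    refine toZ_eq_of_isBigO fun k => ?_
    rw [eq_comm, ← sub_eq_zero, ← map_sub, toZ_eq_zero_iff] at hg
    have h1 := phi_isBigO.mul (hg k)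
    refine (h1.congr_left fun z => ?_).congr_right fun z => (pow_succ' _ _).symm
    rw [mulPhi_coord, mulPhi_coord, ← mul_sub]
    rfl
  rw [h]
  exact (norm_toZ_le _ _).trans_lt ((norm_mulPhi_le g).trans_lt hgr)

/-- Every function in the Calderón space is a weighted function up to a multiple of `phi`. -/
theorem exists_eq_weighted_add_mulPhi (f : Calderon) (hf : ‖f‖ ≤ 1) :
    ∃ (V : ℕ → ℝ) (y : ℕ → ℂ) (g f' : Calderon), (∀ k, 0 < V k) ∧ (∀ k, ‖y k‖ ≤ V k) ∧
      (∀ s : Finset ℕ, ∑ k ∈ s, V k ^ 2 ≤ 1) ∧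
      (∀ z ∈ closedStrip, ∀ k,
        g z k = y k * Complex.exp ((2 * z - 1) * (Real.log (V k) : ℝ))) ∧
      f = (2 : ℂ) • g + mulPhi f' ∧ ‖f'‖ ≤ 12 := by
  -- The geometric term, of total mass 1, keeps the weights positive where `f (1/2)` vanishes.
  set c : ℕ → ℝ := fun k => ‖f (1 / 2) k‖ ^ 2 + 1 / 2 / 2 ^ k with hc
  have hcpos : ∀ k, 0 < c k := fun k => by positivity
  have hsq : ∀ s : Finset ℕ, ∑ k ∈ s, ‖f (1 / 2) k‖ ^ 2 ≤ 1 := fun s =>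
    (f.sum_sq_half_le s).trans (pow_le_one₀ (norm_nonneg _) hf)
  have hsqs : Summable fun k => ‖f (1 / 2) k‖ ^ 2 := summable_of_sum_le (fun k => sq_nonneg _) hsq
  have hgeom' : HasSum (fun k : ℕ => (1 / 2 / 2 ^ k : ℝ)) 1 := by
    have := hasSum_geometric_two' (1 : ℝ)
    simpa using this
  have hcs : Summable c := hsqs.add hgeom'.summable
  have hct : ∑' k, c k ≤ 2 := by
    rw [hsqs.tsum_add hgeom'.summable, hgeom'.tsum_eq]
    linarith [hsqs.tsum_le_of_sum_le hsq]
  obtain ⟨lam, hlam1, hlam, hlams⟩ := hcs.exists_tendsto_atTop_mul_le hcpos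
  have hlampos : ∀ k, 0 < lam k := fun k => one_pos.trans_le (hlam1 k)
  -- Since `∑ lam^2 c ≤ 2 * 2`, halving puts `V` in the unit ball of `ℓ_2`; this is the origin of
  -- the factor 2 in front of `g`.
  set V : ℕ → ℝ := fun k => lam k * √(c k) / 2 with hVdef
  have hV : ∀ k, 0 < V k := fun k =>
    div_pos (mul_pos (hlampos k) (Real.sqrt_pos.2 (hcpos k))) two_pos
  set y : ℕ → ℂ := fun k => (1 / 2 : ℂ) * f (1 / 2) k with hydef
  have hfc : ∀ k, ‖f (1 / 2) k‖ ≤ √(c k) := fun k =>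
    Real.le_sqrt_of_sq_le (le_add_of_nonneg_right (by positivity))
  have hyl : ∀ k, ‖y k‖ ≤ (lam k)⁻¹ * V k := fun k => by
    have h1 : (lam k)⁻¹ * V k = √(c k) / 2 := by
      simp only [hVdef]
      rw [mul_div_assoc, inv_mul_cancel_left₀ (hlampos k).ne']
    rw [h1]
    simp only [hydef]
    rw [norm_mul]
    have h2 : ‖(1 / 2 : ℂ)‖ = 1 / 2 := by norm_num
    rw [h2]
    linarith [hfc k]
  have hyV : ∀ k, ‖y k‖ ≤ V k := fun k =>
    (hyl k).trans (mul_le_of_le_one_left (hV k).le (inv_le_one_of_one_le₀ (hlam1 k)))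
  have hVs : ∀ s : Finset ℕ, ∑ k ∈ s, V k ^ 2 ≤ 1 := fun s => by
    have h1 : ∀ k, V k ^ 2 = 1 / 4 * (lam k ^ 2 * c k) := fun k => by
      simp only [hVdef]
      rw [div_pow, mul_pow, Real.sq_sqrt (hcpos k).le]
      ring
    simp only [h1]
    rw [← Finset.mul_sum]
    linarith [hlams s]
  have hlim : Tendsto (fun k => ‖y k‖ / V k) atTop (𝓝 0) :=
    squeeze_zero (fun k => div_nonneg (norm_nonneg _) (hV k).le)
      (fun k => (div_le_iff₀ (hV k)).2 (hyl k)) hlam.inv_tendsto_atTop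
  obtain ⟨g, hg, hgn⟩ := exists_weighted hV zero_le_one (fun k => by simpa using hyV k) hlim hVs
  have hgn1 : ‖g‖ ≤ 1 := by simpa using hgn
  have h0 : (f - (2 : ℂ) • g) (1 / 2) = 0 := by
    ext k
    change f (1 / 2) k - 2 * g (1 / 2) k = 0
    rw [hg _ half_mem_closedStrip]
    have h1 : (2 * (1 / 2 : ℂ) - 1) = 0 := by norm_num
    rw [h1, zero_mul, Complex.exp_zero, mul_one]
    simp only [hydef]
    ring
  -- The constant 12 is `4 * (1 + 2)`, from division by `phi` and the triangle inequality for `f - 2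
  -- g`.
  obtain ⟨f', hf', hfn⟩ := exists_mulPhi_eq _ h0
  refine ⟨V, y, g, f', hV, hyV, hVs, hg, ?_, hfn.trans ?_⟩
  · rw [hf', add_sub_cancel]
  · have h1 : ‖f - (2 : ℂ) • g‖ ≤ ‖f‖ + ‖(2 : ℂ) • g‖ := norm_sub_le _ _
    have h2 : ‖(2 : ℂ) • g‖ = 2 * ‖g‖ := by
      rw [norm_smul]
      norm_num
    linarith

/-- Induction on `m`: the weighted parts give the full power of the logarithm, while the remainders,
rescaled by `1/12` into the unit ball, are measured in the shorter jet space. The induction starts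
at the trivial space `𝒵_0`. -/
theorem exists_sum_norm_toZ_le (m : ℕ) : ∃ C : ℝ, 0 ≤ C ∧ ∀ N : ℕ, 0 < N → ∀ f : ℕ → Calderon,
    (∀ l, ‖f l‖ ≤ 1) →
      ∑ s ∈ (Finset.range N).powerset, ‖toZ m (∑ l ∈ Finset.range N, signOf s l • f l)‖ ≤
        2 ^ N * (C * (√N * (1 + Real.log N) ^ (m - 1))) := by
  induction m with
  | zero =>
    refine ⟨0, le_rfl, fun N _ f _ => le_of_eq ?_⟩
    have h : ∀ g : Calderon, toZ 0 g = 0 := fun g => Subtype.ext (funext fun i => i.elim0)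
    simp [h]
  | succ m ih =>
    obtain ⟨C₁, hC₁, h₁⟩ := exists_sum_norm_toZ_weighted_le (m + 1)
    obtain ⟨C₂, hC₂, h₂⟩ := ih
    refine ⟨2 * C₁ + 12 * C₂, by positivity, fun N hN f hf => ?_⟩
    choose V y g f' hV hy hVs hg hfg hf' using fun l => exists_eq_weighted_add_mulPhi (f l) (hf l)
    have hL : 1 ≤ 1 + Real.log N :=
      le_add_of_nonneg_right (Real.log_nonneg (by exact_mod_cast hN))
    have h1 := h₁ N hN V y g hV hy hVs hg
    have h2 := h₂ N hN (fun l => (1 / 12 : ℂ) • f' l) fun l => by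
      rw [norm_smul]
      have : ‖(1 / 12 : ℂ)‖ = 1 / 12 := by norm_num
      rw [this]
      linarith [hf' l]
    have h3 : ∀ s, ‖toZ (m + 1) (∑ l ∈ Finset.range N, signOf s l • f l)‖ ≤
        2 * ‖toZ (m + 1) (∑ l ∈ Finset.range N, signOf s l • g l)‖ +
        12 * ‖toZ m (∑ l ∈ Finset.range N, signOf s l • (1 / 12 : ℂ) • f' l)‖ := fun s => by
      have h4 : ∑ l ∈ Finset.range N, signOf s l • f l =
          (2 : ℂ) • ∑ l ∈ Finset.range N, signOf s l • g l +
          (12 : ℂ) • mulPhi (∑ l ∈ Finset.range N, signOf s l • (1 / 12 : ℂ) • f' l) := by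
        rw [map_sum, Finset.smul_sum, Finset.smul_sum, ← Finset.sum_add_distrib]
        refine Finset.sum_congr rfl fun l _ => ?_
        conv_lhs => rw [hfg l]
        rw [map_smul, map_smul, smul_add, smul_comm (2 : ℂ), smul_comm (12 : ℂ), smul_smul (12 : ℂ)]
        norm_num
      rw [h4, map_add, map_smul, map_smul]
      refine (norm_add_le _ _).trans ?_
      rw [norm_smul, norm_smul]
      have h5 : ‖(2 : ℂ)‖ = 2 := by norm_num
      have h6 : ‖(12 : ℂ)‖ = 12 := by norm_num
      rw [h5, h6]
      exact add_le_add le_rfl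
        (mul_le_mul_of_nonneg_left (norm_toZ_succ_mulPhi_le m _) (by norm_num))
    refine (Finset.sum_le_sum fun s _ => h3 s).trans ?_
    rw [Finset.sum_add_distrib, ← Finset.mul_sum, ← Finset.mul_sum]
    have h7 : (1 + Real.log N) ^ (m - 1) ≤ (1 + Real.log N) ^ (m + 1 - 1) :=
      pow_le_pow_right₀ hL (by omega)
    have h8 : 2 ^ N * (C₂ * (√N * (1 + Real.log N) ^ (m - 1))) ≤
        2 ^ N * (C₂ * (√N * (1 + Real.log N) ^ (m + 1 - 1))) := by gcongr
    linarith

/-! ### Lower bound for signed sums of unit vectors -/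

/-- The constant function with values on a coordinate axis. -/
theorem exists_const_single (i : ℕ) : ∃ f : Calderon,
    (∀ z ∈ closedStrip, ∀ k, f z k = Pi.single (M := fun _ => ℂ) i 1 k) ∧ ‖f‖ ≤ 1 := by
  have hd : DiffContOnCl ℂ (fun _ : ℂ => (lp.single ∞ i 1 : LInf)) strip := diffContOnCl_const
  have hb : ∃ C : ℝ, ∀ z ∈ closedStrip, ‖(fun _ : ℂ => (lp.single ∞ i 1 : LInf)) z‖ ≤ C :=
    ⟨_, fun _ _ => le_rfl⟩
  have hval : ∀ z ∈ closedStrip, ∀ k,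
      ofFun _ hd hb (.const ℝ (lp.single 1 i 1 : LOne)) (fun _ _ => rfl) z k =
        Pi.single (M := fun _ => ℂ) i 1 k := fun z hz k =>
    congrArg (fun v : LInf => v k) (ofFun_apply hd hb _ _ hz)
  have hnorm : ∀ k, ‖Pi.single (M := fun _ => ℂ) i 1 k‖ = if k = i then 1 else 0 := fun k => by
    rw [Pi.single_apply]
    split_ifs <;> simp
  refine ⟨_, hval, norm_le_of_forall _ zero_le_one (fun t k => ?_) fun t s => ?_⟩
  · rw [hval _ (I_mul_mem_closedStrip t), hnorm]
    split_ifs <;> simp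
  · simp only [hval _ (one_add_I_mul_mem_closedStrip t), hnorm, Finset.sum_ite_eq']
    split_ifs <;> simp

/-- The function `h z = N^(z-1) ∑ ε_k f_k(z)` is bounded by `‖f‖`: on the left edge `N^(-1)`
compensates for the `N` coordinates, on the right edge the `ℓ_1` norm suffices. At `1/2` it agrees
with `N^z` through order `m`, whose `m`-th derivative there is `√N (log N)^m`. Cauchy's estimate on
radius `1/4` yields `4 ^ m`. -/
theorem le_norm_of_toZ_eq {m N : ℕ} (hN : 0 < N) {e : ℕ → Calderon}
    (he : ∀ i, ∀ z ∈ closedStrip, ∀ k, e i z k = Pi.single (M := fun _ => ℂ) i 1 k)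
    (s : Finset ℕ) {f : Calderon}
    (hf : toZ (m + 1) f = toZ (m + 1) (∑ l ∈ Finset.range N, signOf s l • e l)) :
    √N * Real.log N ^ m ≤ m.factorial * 4 ^ m * ‖f‖ := by
  have hN0 : (0 : ℝ) < N := by exact_mod_cast hN
  set x : ℂ := ((Real.log N : ℝ) : ℂ) with hx
  set h : ℂ → ℂ := fun z =>
    (∑ k ∈ Finset.range N, signOf s k * f z k) * Complex.exp ((z - 1) * x) with hh
  have hexp : ∀ z : ℂ, ‖Complex.exp ((z - 1) * x)‖ = Real.exp ((z.re - 1) * Real.log N) :=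
    fun z => by
    rw [Complex.norm_exp, hx, mul_comm, Complex.re_ofReal_mul, Complex.sub_re, Complex.one_re,
      mul_comm]
  have hcoord : ∀ k, DiffContOnCl ℂ (fun z => f z k) strip := fun k =>
    (lp.evalCLM ℂ (fun _ : ℕ => ℂ) ∞ k).differentiable.comp_diffContOnCl
      f.isCalderon.diffContOnCl
  have hd : DiffContOnCl ℂ h strip := by
    have h1 : DiffContOnCl ℂ (fun z => ∑ k ∈ Finset.range N, signOf s k * f z k) strip :=
      ⟨DifferentiableOn.fun_sum fun k _ => (hcoord k).differentiableOn.const_mul _,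
        continuousOn_finsetSum _ fun k _ => continuousOn_const.mul (hcoord k).continuousOn⟩
    have h2 : Differentiable ℂ fun z : ℂ => Complex.exp ((z - 1) * x) := by fun_prop
    exact h1.smul h2.diffContOnCl
  have hsum : ∀ z, ‖∑ k ∈ Finset.range N, signOf s k * f z k‖ ≤ N * ‖f‖ := fun z => by
    refine (norm_sum_le_of_le _ (f := fun k => signOf s k * f z k) (n := fun _ => ‖f‖)
      fun k _ => ?_).trans (le_of_eq (by simp))
    rw [norm_mul, norm_signOf, one_mul]
    exact f.norm_coord_le z k
  have hlogN : 0 ≤ Real.log N := Real.log_nonneg (by exact_mod_cast hN)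
  have hbd : ∀ z ∈ closedStrip, ‖h z‖ ≤ ‖f‖ := fun z hz => by
    refine norm_le_of_boundary (C := N * ‖f‖ * 1) hd (fun z hz => ?_) (fun t => ?_) (fun t => ?_) hz
    · simp only [hh]
      rw [norm_mul, hexp]
      refine mul_le_mul (hsum z) (Real.exp_le_one_iff.2 ?_) (Real.exp_pos _).le (by positivity)
      exact mul_nonpos_of_nonpos_of_nonneg (by linarith [hz.2]) hlogN
    · simp only [hh]
      rw [norm_mul, hexp]
      have h1 : Real.exp (((Complex.I * t).re - 1) * Real.log N) = (N : ℝ)⁻¹ := by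
        simp [Real.exp_neg, Real.exp_log hN0]
      rw [h1, ← div_eq_mul_inv, div_le_iff₀ hN0]
      exact (hsum _).trans (le_of_eq (mul_comm _ _))
    · simp only [hh]
      rw [norm_mul, hexp]
      have h1 : Real.exp (((1 + Complex.I * t).re - 1) * Real.log N) = 1 := by simp
      rw [h1, mul_one]
      refine (norm_sum_le_of_le _ fun k _ => ?_).trans (f.sum_norm_right_le t (Finset.range N))
      rw [norm_mul, norm_signOf, one_mul]
  have hball : Metric.closedBall (1 / 2 : ℂ) (1 / 4) ⊆ strip := fun z hz => by
    have h1 : |(z - 1 / 2).re| ≤ 1 / 4 :=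
      (Complex.abs_re_le_norm _).trans (by simpa [dist_eq_norm] using hz)
    have h2 : (z - 1 / 2).re = z.re - 1 / 2 := by simp
    rw [h2, abs_le] at h1
    exact ⟨by linarith, by linarith⟩
  have hcauchy : ‖iteratedDeriv m h (1 / 2)‖ ≤ m.factorial * ‖f‖ / (1 / 4 : ℝ) ^ m :=
    Complex.norm_iteratedDeriv_le_of_forall_mem_sphere_norm_le m (by norm_num)
      (hd.mono (Metric.ball_subset_closedBall.trans hball)) fun z hz =>
        hbd z (closure_strip ▸ subset_closure (hball (Metric.sphere_subset_closedBall hz)))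
  have hanal : AnalyticAt ℂ h (1 / 2) :=
    hd.differentiableOn.analyticAt (isOpen_strip.mem_nhds half_mem)
  have hE : AnalyticAt ℂ (fun z : ℂ => Complex.exp (x * z)) (1 / 2) := by fun_prop
  have hO : (h - fun z : ℂ => Complex.exp (x * z)) =O[𝓝 (1 / 2)]
      fun z => (z - 1 / 2) ^ (m + 1) := by
    rw [← sub_eq_zero, ← map_sub, toZ_eq_zero_iff] at hf
    have h1 : (fun z => Complex.exp ((z - 1) * x) * ∑ k ∈ Finset.range N, signOf s k *
        (f - ∑ l ∈ Finset.range N, signOf s l • e l) z k) =O[𝓝 (1 / 2)]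
          fun z => (z - 1 / 2) ^ (m + 1) := by
      have h2 : (fun z : ℂ => Complex.exp ((z - 1) * x)) =O[𝓝 (1 / 2)] fun _ => (1 : ℂ) :=
        Tendsto.isBigO_one ℂ (ContinuousAt.tendsto (by fun_prop))
      simpa only [one_mul] using
        h2.mul (IsBigO.fun_sum fun k (_ : k ∈ Finset.range N) => (hf k).const_mul_left (signOf s k))
    refine h1.congr' ?_ EventuallyEq.rfl
    filter_upwards [eventually_mem_closedStrip] with z hz
    -- Each sign meets itself, so every coordinate contributes 1 and the signs disappear from the
    -- comparison function.
    have h3 : ∀ k ∈ Finset.range N, signOf s k *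
        (f - ∑ l ∈ Finset.range N, signOf s l • e l) z k = signOf s k * f z k - 1 := fun k hk => by
      have h4 : (f - ∑ l ∈ Finset.range N, signOf s l • e l) z k =
          f z k - (∑ l ∈ Finset.range N, signOf s l • e l) z k := rfl
      have h5 : signOf s k * signOf s k = 1 := by
        unfold signOf
        split_ifs <;> norm_num
      rw [h4, sum_coord]
      simp only [smul_coord, he _ z hz, Pi.single_apply, mul_ite, mul_one, mul_zero,
        Finset.sum_ite_eq, if_pos hk]
      rw [mul_sub, h5]
    rw [Finset.sum_congr rfl h3, Finset.sum_sub_distrib, Finset.sum_const, Finset.card_range,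
      nsmul_eq_mul, mul_one, Pi.sub_apply, mul_sub]
    have h6 : Complex.exp ((z - 1) * x) * N = Complex.exp (x * z) := by
      have h7 : Complex.exp x = N := by
        rw [hx, ← Complex.ofReal_exp, Real.exp_log hN0, Complex.ofReal_natCast]
      rw [← h7, ← Complex.exp_add]
      congr 1
      ring
    rw [h6, mul_comm]
  have hder := ((hanal.sub hE).isBigO_pow_iff_iteratedDeriv_eq_zero (m + 1)).1 hO m m.lt_succ_self
  rw [iteratedDeriv_sub hanal.contDiffAt hE.contDiffAt, sub_eq_zero, iteratedDeriv_cexp_const_mul]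
    at hder
  have hval : ‖x ^ m * Complex.exp (x * (1 / 2))‖ = √N * Real.log N ^ m := by
    rw [norm_mul, norm_pow, hx, Complex.norm_real, Real.norm_of_nonneg hlogN, Complex.norm_exp,
      mul_comm]
    congr 1
    have h1 : (((Real.log N : ℝ) : ℂ) * (1 / 2)).re = Real.log N / 2 := by
      rw [Complex.re_ofReal_mul, div_eq_mul_one_div]
      norm_num
      ring
    rw [h1, Real.exp_half, Real.exp_log hN0]
  rw [hder, hval] at hcauchy
  refine hcauchy.trans (le_of_eq ?_)
  rw [div_pow, one_pow, div_div_eq_mul_div, div_one]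
  ring

end Calderon

/-! ### Comparison of the growth rates -/

/-- The averages of random signed sums in `𝒵_m` grow at most like `√N (log N) ^ (m - 1)`. -/
theorem Z.exists_sum_norm_le (m : ℕ) (K : ℝ) (hK : 0 ≤ K) : ∃ C : ℝ, 0 ≤ C ∧ ∀ N : ℕ, 0 < N →
    ∀ w : ℕ → Z m, (∀ l, ‖w l‖ ≤ K) →
      ∑ s ∈ (Finset.range N).powerset, ‖∑ l ∈ Finset.range N, signOf s l • w l‖ ≤
        2 ^ N * (C * (√N * (1 + Real.log N) ^ (m - 1))) := by
  obtain ⟨C, hC, h⟩ := Calderon.exists_sum_norm_toZ_le m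
  refine ⟨(K + 1) * C, by positivity, fun N hN w hw => ?_⟩
  -- The infimum in the quotient norm need not be attained; `K + 1` leaves room and is nonzero for
  -- rescaling.
  choose f hf hfn using fun l => Calderon.exists_toZ_eq (w l) ((hw l).trans_lt (lt_add_one K))
  have hK1 : ((K + 1 : ℝ) : ℂ) ≠ 0 := by
    rw [Complex.ofReal_ne_zero]
    positivity
  have hKn : ‖((K + 1 : ℝ) : ℂ)‖ = K + 1 := by
    rw [Complex.norm_real, Real.norm_of_nonneg (by positivity)]
  have h1 := h N hN (fun l => ((K + 1 : ℝ) : ℂ)⁻¹ • f l) fun l => by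
    rw [norm_smul, norm_inv, hKn, inv_mul_le_one₀ (by positivity)]
    exact (hfn l).le
  have h2 : ∀ s, ‖∑ l ∈ Finset.range N, signOf s l • w l‖ = (K + 1) *
      ‖Calderon.toZ m (∑ l ∈ Finset.range N, signOf s l • ((K + 1 : ℝ) : ℂ)⁻¹ • f l)‖ :=
    fun s => by
    have h3 : ∑ l ∈ Finset.range N, signOf s l • w l = ((K + 1 : ℝ) : ℂ) •
        Calderon.toZ m (∑ l ∈ Finset.range N, signOf s l • ((K + 1 : ℝ) : ℂ)⁻¹ • f l) := by
      rw [map_sum, Finset.smul_sum]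
      refine Finset.sum_congr rfl fun l _ => ?_
      rw [map_smul, map_smul, hf, smul_comm ((K + 1 : ℝ) : ℂ),
        smul_smul ((K + 1 : ℝ) : ℂ), mul_inv_cancel₀ hK1,
        one_smul]
    rw [h3, norm_smul, hKn]
  simp only [h2]
  rw [← Finset.mul_sum]
  refine (mul_le_mul_of_nonneg_left h1 (by positivity)).trans (le_of_eq (by ring))

end Rochberg

theorem mainTheorem4 (n k : ℕ) (hn : 1 ≤ n) (hk : 1 ≤ k) :
    ¬ Nonempty (Rochberg.Z (n + k) ≃L[ℂ] Rochberg.Z n × Rochberg.Z k) := by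
  rintro ⟨T⟩
  -- The lower bound then has exponent `m + 1`, and both `n - 1` and `k - 1` are at most `m` because
  -- `n, k ≥ 1`.
  obtain ⟨m, hm⟩ : ∃ m, n + k = m + 1 + 1 := ⟨n + k - 2, by omega⟩
  choose e he hen using Rochberg.Calderon.exists_const_single
  set u : ℕ → Rochberg.Z (n + k) := fun l => Rochberg.Calderon.toZ (n + k) (e l) with hu
  have hun : ∀ l, ‖u l‖ ≤ 1 := fun l => (Rochberg.Calderon.norm_toZ_le _ _).trans (hen l)
  set K : ℝ := ‖(T : Rochberg.Z (n + k) →L[ℂ] Rochberg.Z n × Rochberg.Z k)‖ with hK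
  set K' : ℝ := ‖(T.symm : Rochberg.Z n × Rochberg.Z k →L[ℂ] Rochberg.Z (n + k))‖ with hK'
  have hTu : ∀ l, ‖T (u l)‖ ≤ K := fun l =>
    ((T : Rochberg.Z (n + k) →L[ℂ] Rochberg.Z n × Rochberg.Z k).le_opNorm (u l)).trans
      (mul_le_of_le_one_right (norm_nonneg _) (hun l))
  obtain ⟨C₁, hC₁, h₁⟩ := Rochberg.Z.exists_sum_norm_le n K (norm_nonneg _)
  obtain ⟨C₂, hC₂, h₂⟩ := Rochberg.Z.exists_sum_norm_le k K (norm_nonneg _)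
  set c : ℝ := (m + 1).factorial * 4 ^ (m + 1) with hc
  have hc0 : 0 < c := by positivity
  have key : ∀ N : ℕ, 1 ≤ Real.log N → Real.log N ≤ c * (K' * (C₁ + C₂)) * 2 ^ m := fun N hlog => by
    have hN : 0 < N := by
      rcases N.eq_zero_or_pos with rfl | h
      · norm_num at hlog
      · exact h
    have hsqrt : 0 < √(N : ℝ) := Real.sqrt_pos.2 (by exact_mod_cast hN)
    have hL : 1 ≤ 1 + Real.log N := by linarith
    have hlow : ∀ s, √N * Real.log N ^ (m + 1) ≤
        c * ‖∑ l ∈ Finset.range N, Rochberg.signOf s l • u l‖ := fun s => by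
      rw [← div_le_iff₀' hc0]
      refine le_of_forall_gt fun r hr => ?_
      obtain ⟨f, hf, hfr⟩ := Rochberg.Calderon.exists_toZ_eq _ hr
      refine lt_of_le_of_lt ?_ hfr
      rw [div_le_iff₀' hc0]
      refine Rochberg.Calderon.le_norm_of_toZ_eq hN he s ?_
      rw [← hm, hf, map_sum]
      simp only [hu, map_smul]
    have hup : ∀ s, ‖∑ l ∈ Finset.range N, Rochberg.signOf s l • u l‖ ≤
        K' * (‖∑ l ∈ Finset.range N, Rochberg.signOf s l • (T (u l)).1‖ +
          ‖∑ l ∈ Finset.range N, Rochberg.signOf s l • (T (u l)).2‖) := fun s => by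
      set v := ∑ l ∈ Finset.range N, Rochberg.signOf s l • u l with hv
      have hTv : T v = (∑ l ∈ Finset.range N, Rochberg.signOf s l • (T (u l)).1,
          ∑ l ∈ Finset.range N, Rochberg.signOf s l • (T (u l)).2) := by
        rw [hv, map_sum]
        simp only [map_smul]
        refine Prod.ext ?_ ?_
        · rw [Prod.fst_sum]
          rfl
        · rw [Prod.snd_sum]
          rfl
      have h3 := (T.symm : Rochberg.Z n × Rochberg.Z k →L[ℂ] Rochberg.Z (n + k)).le_opNorm (T v)
      rw [ContinuousLinearEquiv.coe_coe, T.symm_apply_apply] at h3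
      refine h3.trans (mul_le_mul_of_nonneg_left ?_ (norm_nonneg _))
      rw [hTv, Prod.norm_def]
      exact max_le (le_add_of_nonneg_right (norm_nonneg _)) (le_add_of_nonneg_left (norm_nonneg _))
    have h3 := h₁ N hN (fun l => (T (u l)).1) fun l => (norm_fst_le _).trans (hTu l)
    have h4 := h₂ N hN (fun l => (T (u l)).2) fun l => (norm_snd_le _).trans (hTu l)
    have h5 : (1 + Real.log N) ^ (n - 1) ≤ (1 + Real.log N) ^ m := pow_le_pow_right₀ hL (by omega)
    have h6 : (1 + Real.log N) ^ (k - 1) ≤ (1 + Real.log N) ^ m := pow_le_pow_right₀ hL (by omega)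
    have h7 : (1 + Real.log N) ^ m ≤ 2 ^ m * Real.log N ^ m := by
      rw [← mul_pow]
      exact pow_le_pow_left₀ (by linarith) (by linarith) m
    -- The lower bound holds for every choice of signs, so summing over all `2 ^ N` of them matches
    -- the averaged upper bounds without loss.
    have h8 : (2 : ℝ) ^ N * (√N * Real.log N ^ (m + 1)) ≤
        2 ^ N * (c * (K' * (C₁ + C₂)) * 2 ^ m * (√N * Real.log N ^ m)) := by
      calc (2 : ℝ) ^ N * (√N * Real.log N ^ (m + 1))
          = ∑ s ∈ (Finset.range N).powerset, √N * Real.log N ^ (m + 1) := by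
            rw [Finset.sum_const, Finset.card_powerset, Finset.card_range, nsmul_eq_mul]
            push_cast
            rfl
        _ ≤ ∑ s ∈ (Finset.range N).powerset, c * (K' *
            (‖∑ l ∈ Finset.range N, Rochberg.signOf s l • (T (u l)).1‖ +
              ‖∑ l ∈ Finset.range N, Rochberg.signOf s l • (T (u l)).2‖)) :=
            Finset.sum_le_sum fun s _ =>
              (hlow s).trans (mul_le_mul_of_nonneg_left (hup s) hc0.le)
        _ ≤ c * (K' * (2 ^ N * (C₁ * (√N * (1 + Real.log N) ^ (n - 1))) +
            2 ^ N * (C₂ * (√N * (1 + Real.log N) ^ (k - 1))))) := by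
            rw [← Finset.mul_sum, ← Finset.mul_sum, Finset.sum_add_distrib]
            exact mul_le_mul_of_nonneg_left (mul_le_mul_of_nonneg_left (add_le_add h3 h4)
              (norm_nonneg _)) hc0.le
        _ ≤ c * (K' * (2 ^ N * (C₁ * (√N * (2 ^ m * Real.log N ^ m))) +
            2 ^ N * (C₂ * (√N * (2 ^ m * Real.log N ^ m))))) := by
            have := h5.trans h7
            have := h6.trans h7
            gcongr
        _ = _ := by ring
    have h9 := le_of_mul_le_mul_left h8 (by positivity)
    have h10 : 0 < √(N : ℝ) * Real.log N ^ m := mul_pos hsqrt (pow_pos (by linarith) m)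
    refine le_of_mul_le_mul_right ?_ h10
    refine le_trans (le_of_eq ?_) h9
    ring
  have hlim : Filter.Tendsto (fun N : ℕ => Real.log N) Filter.atTop Filter.atTop :=
    Real.tendsto_log_atTop.comp tendsto_natCast_atTop_atTop
  obtain ⟨N, hN1, hN2⟩ := ((hlim.eventually_ge_atTop 1).and
    (hlim.eventually_gt_atTop (c * (K' * (C₁ + C₂)) * 2 ^ m))).exists
  exact absurd (key N hN1) (not_le.2 hN2)
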